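/- Let $X$ be a locally compact Hausdorff space on which a finite group $W$ acts by homeomorphisms, and let $H$ be a complex Hilbert space. Suppose given an action of $W$ on $(X,H)$, that is, an action of $W$ by homeomorphisms on $X\times H$ of the form $w(x,\xi)=(wx,I_{w,x}\xi)$, where each $I_{w,x}:H\to H$ is a unitary operator. Let $W$ act on the $C^*$-algebra $C_0(X,\operatorname{K}(H))$, where $\operatorname{K}(H)$ is the algebra of compact operators on $H$, by $\alpha_w(k)(x)=I_{w,w^{-1}x}\,k(w^{-1}x)\,I_{w^{-1},x}$, and let $A=C_0(X,\operatorname{K}(H))^W$ be the fixed-point algebra. For $x\in X$ let $W_x=\{w\in W : wx=x\}$ be the isotropy group and let $I_x:w\mapsto I_{w,x}$ be the resulting unitary representation of $W_x$ on $H$. For an irreducible unitary representation $\rho$ of $W_x$ on a (necessarily finite-dimensional) Hilbert space $H_\rho$, let $\operatorname{HS}(\rho,I_x)^{W_x}$ be the Hilbert space of all linear maps $s:H_\rho\to H$ with $s\rho(w)=I_{w,x}s$ for all $w\in W_x$, with inner product $\langle r\,|\,s\rangle=\operatorname{trace}(r^*s)$. Say that $\rho$ occurs in $I_x$, and write $\rho\subseteq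 I_x$, if $\rho$ is unitarily equivalent to a subrepresentation of $I_x$. A representation of $A$ is a $*$-homomorphism $\pi:A\to\operatorname{B}(K)$ for a Hilbert space $K$. It is irreducible if $\pi\neq 0$ and $K$ has no closed $\pi(A)$-invariant subspaces other than $0$ and $K$; and two representations are equivalent if a unitary operator intertwines them. The dual $\widehat{A}$ is the set of equivalence classes of irreducible representations of $A$, and $\widehat{W_x}$ is the set of (unitary) equivalence classes of irreducible unitary representations of $W_x$. 1. For each $x\in X$ and each irreducible unitary representation $\rho$ of $W_x$ occurring in $I_x$, the map $$\pi_{x,\rho}:A\to \operatorname{B}(\operatorname{HS}(\rho,I_x)^{W_x}),\qquad \pi_{x,\rho}(k):s\mapsto k(x)\circ s,$$ is an irreducible representation of $A$. 2. Every irreducible representation of $A$ is equivalent to $\pi_{x,\rho}$ for some $x\in X$ and some $\rho$ as in (1). 3. Two representations $\pi_{x_1,\rho_1}$ and $\pi_{x_2,\rho_2}$ as in (1) are equivalent if and only if there is some $w\in W$ such that $x_2=wx_1$ and such that $\rho_2$ is equivalent to the representation $w\rho_1:v\mapsto\rho_1(w^{-1}vw)$ of $W_{x_2}$. Consequently, if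 one point $x$ is chosen (arbitrarily) in each $W$-orbit $Wx$, the map $(Wx,\rho)\mapsto\pi_{x,\rho}$ induces a bijection between $$\{(Wx,\rho)\ :\ Wx\in W\backslash X,\ \rho\in\widehat{W_x},\ \rho\subseteq I_x\}$$ and $\widehat{A}$. -/

import Mathlib

open scoped ZeroAtInfty InnerProductSpace

universe u v w r z

namespace EquivariantCompacts

noncomputable section

/-! ## Representations of `*`-algebras on Hilbert spaces -/

section Representations

variable {A : Type u} [NonUnitalRing A] [StarRing A] [Module ℂ A]

/-- A representation of a `*`-algebra is irreducible if it is not the zero map (so in particular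
its space is nonzero) and the only closed invariant subspaces are the two trivial ones. -/
def IsIrreducibleRep {K : Type v} [NormedAddCommGroup K] [InnerProductSpace ℂ K]
    [CompleteSpace K] (π : A →⋆ₙₐ[ℂ] (K →L[ℂ] K)) : Prop :=
  (∃ a, π a ≠ 0) ∧
    ∀ S : Submodule ℂ K, IsClosed (S : Set K) → (∀ a, ∀ ξ ∈ S, π a ξ ∈ S) → S = ⊥ ∨ S = ⊤

/-- Unitary equivalence of representations of a `*`-algebra. -/
def RepEquiv {K₁ : Type v} [NormedAddCommGroup K₁] [InnerProductSpace ℂ K₁] [CompleteSpace K₁]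
    {K₂ : Type w} [NormedAddCommGroup K₂] [InnerProductSpace ℂ K₂] [CompleteSpace K₂]
    (π₁ : A →⋆ₙₐ[ℂ] (K₁ →L[ℂ] K₁)) (π₂ : A →⋆ₙₐ[ℂ] (K₂ →L[ℂ] K₂)) : Prop :=
  ∃ t : K₁ ≃ₗᵢ[ℂ] K₂, ∀ a ξ, t (π₁ a ξ) = π₂ a (t ξ)

variable (A) in
/-- A Hilbert space together with a representation of `A` on it. -/
structure HilbertRep where
  carrier : Type v
  [normed : NormedAddCommGroup carrier]
  [inner : InnerProductSpace ℂ carrier]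
  [complete : CompleteSpace carrier]
  hom : A →⋆ₙₐ[ℂ] (carrier →L[ℂ] carrier)

attribute [instance] HilbertRep.normed HilbertRep.inner HilbertRep.complete

variable (A) in
instance HilbertRep.setoid : Setoid (HilbertRep.{u, v} A) where
  r π₁ π₂ := RepEquiv π₁.hom π₂.hom
  iseqv :=
    { refl := fun _ => ⟨LinearIsometryEquiv.refl ℂ _, fun _ _ => rfl⟩
      symm := fun {π₁ π₂} ⟨t, ht⟩ => ⟨t.symm, fun a ξ => by
        rw [LinearIsometryEquiv.symm_apply_eq, ht, LinearIsometryEquiv.apply_symm_apply]⟩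
      trans := fun ⟨t, ht⟩ ⟨s, hs⟩ => ⟨t.trans s, fun a ξ => by simp [ht, hs]⟩ }

variable (A) in
/-- Equivalence classes of representations of `A`. -/
abbrev RepClass : Type (max u (v + 1)) := Quotient (HilbertRep.setoid.{u, v} A)

variable (A) in
/-- The dual of `A`: the set of equivalence classes of irreducible representations. -/
def dual : Set (RepClass.{u, v} A) :=
  {c | ∃ π : HilbertRep.{u, v} A, IsIrreducibleRep π.hom ∧ Quotient.mk _ π = c}

end Representations

/-! ## Unitary representations of (finite) groups -/

section Groups

variable {G : Type u} [Group G]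

/-- A unitary representation of a finite group is irreducible if its space is nonzero and has no
closed invariant subspaces other than the two trivial ones. -/
def IsIrreducibleUnitary {V : Type v} [NormedAddCommGroup V] [InnerProductSpace ℂ V]
    (ρ : G →* (V ≃ₗᵢ[ℂ] V)) : Prop :=
  Nontrivial V ∧
    ∀ S : Submodule ℂ V, IsClosed (S : Set V) → (∀ g, ∀ ξ ∈ S, ρ g ξ ∈ S) → S = ⊥ ∨ S = ⊤

/-- `ρ` occurs in `π`: it is unitarily equivalent to the restriction of `π` to some closed
invariant subspace (the range of `t`). -/
def Occurs {V : Type v} [NormedAddCommGroup V] [InnerProductSpace ℂ V]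
    {H : Type w} [NormedAddCommGroup H] [InnerProductSpace ℂ H]
    (ρ : G →* (V ≃ₗᵢ[ℂ] V)) (π : G →* (H ≃ₗᵢ[ℂ] H)) : Prop :=
  ∃ t : V →ₗᵢ[ℂ] H, ∀ g ζ, t (ρ g ζ) = π g (t ζ)

variable (G) in
/-- An irreducible unitary representation of a finite group on a Hilbert space. -/
structure UnitaryIrrep where
  carrier : Type r
  [normed : NormedAddCommGroup carrier]
  [inner : InnerProductSpace ℂ carrier]
  [complete : CompleteSpace carrier]
  hom : G →* (carrier ≃ₗᵢ[ℂ] carrier)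
  irreducible : IsIrreducibleUnitary hom

attribute [instance] UnitaryIrrep.normed UnitaryIrrep.inner UnitaryIrrep.complete

/-- Unitary equivalence of irreducible unitary representations. -/
def UnitaryIrrep.Equiv (ρ₁ ρ₂ : UnitaryIrrep.{u, r} G) : Prop :=
  ∃ t : ρ₁.carrier ≃ₗᵢ[ℂ] ρ₂.carrier, ∀ g ζ, t (ρ₁.hom g ζ) = ρ₂.hom g (t ζ)

variable (G) in
instance UnitaryIrrep.setoid : Setoid (UnitaryIrrep.{u, r} G) where
  r := UnitaryIrrep.Equiv
  iseqv :=
    { refl := fun _ => ⟨LinearIsometryEquiv.refl ℂ _, fun _ _ => rfl⟩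
      symm := fun {π₁ π₂} ⟨t, ht⟩ => ⟨t.symm, fun a ξ => by
        rw [LinearIsometryEquiv.symm_apply_eq, ht, LinearIsometryEquiv.apply_symm_apply]⟩
      trans := fun ⟨t, ht⟩ ⟨s, hs⟩ => ⟨t.trans s, fun a ξ => by simp [ht, hs]⟩ }

variable (G) in
/-- The unitary dual of a finite group: equivalence classes of irreducible unitary
representations. -/
abbrev UnitaryDual : Type (max u (r + 1)) := Quotient (UnitaryIrrep.setoid.{u, r} G)

/-- Irreducible unitary representations of finite groups are finite-dimensional. -/
theorem IsIrreducibleUnitary.finiteDimensional [Finite G] {V : Type v} [NormedAddCommGroup V]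
    [InnerProductSpace ℂ V] {ρ : G →* (V ≃ₗᵢ[ℂ] V)} (h : IsIrreducibleUnitary ρ) :
    FiniteDimensional ℂ V := by
  obtain ⟨hn, h⟩ := h
  obtain ⟨ξ, hξ⟩ := exists_ne (0 : V)
  let S : Submodule ℂ V := Submodule.span ℂ (Set.range fun g => ρ g ξ)
  have hS : FiniteDimensional ℂ S := FiniteDimensional.span_of_finite ℂ (Set.finite_range _)
  have hmem : ξ ∈ S := Submodule.subset_span ⟨1, by simp⟩
  rcases h S S.closed_of_finiteDimensional (by
    intro g η hη
    have : S ≤ S.comap ((ρ g).toLinearEquiv : V →ₗ[ℂ] V) := by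
      rw [Submodule.span_le]
      rintro _ ⟨g', rfl⟩
      exact Submodule.subset_span ⟨g * g', by simp⟩
    exact this hη) with h0 | h1
  · rw [h0] at hmem
    exact absurd ((Submodule.mem_bot ℂ).1 hmem) hξ
  · rw [h1] at hS
    exact Module.Finite.equiv (Submodule.topEquiv : (⊤ : Submodule ℂ V) ≃ₗ[ℂ] V)

instance [Finite G] (ρ : UnitaryIrrep.{u, r} G) : FiniteDimensional ℂ ρ.carrier :=
  ρ.irreducible.finiteDimensional

end Groups

/-! ## The Hilbert space `HS(ρ, π)^G` of intertwiners -/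

section HS

variable {G : Type u} [Group G]
  {V : Type r} [NormedAddCommGroup V] [InnerProductSpace ℂ V]
  {H : Type w} [NormedAddCommGroup H] [InnerProductSpace ℂ H]

/-- The subspace of `G`-equivariant linear maps from `V` to `H`. -/
def intertwiners (ρ : G →* (V ≃ₗᵢ[ℂ] V)) (π : G →* (H ≃ₗᵢ[ℂ] H)) : Submodule ℂ (V →L[ℂ] H) where
  carrier := {s | ∀ g ζ, s (ρ g ζ) = π g (s ζ)}
  add_mem' := fun ha hb g ζ => by simp [ha g ζ, hb g ζ]
  zero_mem' := fun g ζ => by simp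
  smul_mem' := fun c s hs g ζ => by simp [hs g ζ]

/-- `HS(ρ, π)^G`: the space of `G`-equivariant linear maps from the finite-dimensional space `V` to
`H`, which is given below the Hilbert--Schmidt inner product `⟪r, s⟫ = trace (r* s)`.
(This is a type synonym, so that it does not inherit the operator norm.) -/
def HSInt (ρ : G →* (V ≃ₗᵢ[ℂ] V)) (π : G →* (H ≃ₗᵢ[ℂ] H)) : Type (max r w) := intertwiners ρ π

variable {ρ : G →* (V ≃ₗᵢ[ℂ] V)} {π : G →* (H ≃ₗᵢ[ℂ] H)}

instance : AddCommGroup (HSInt ρ π) := inferInstanceAs (AddCommGroup (intertwiners ρ π))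

instance : Module ℂ (HSInt ρ π) := inferInstanceAs (Module ℂ (intertwiners ρ π))

/-- The linear map underlying an element of `HS(ρ, π)^G`. -/
def HSInt.toCLM : HSInt ρ π →ₗ[ℂ] (V →L[ℂ] H) := (intertwiners ρ π).subtype

/-- The element of `HS(ρ, π)^G` given by an equivariant map. -/
def HSInt.mk (s : V →L[ℂ] H) (hs : ∀ g ζ, s (ρ g ζ) = π g (s ζ)) : HSInt ρ π := ⟨s, hs⟩

@[simp]
theorem HSInt.toCLM_mk (s : V →L[ℂ] H) (hs : ∀ g ζ, s (ρ g ζ) = π g (s ζ)) :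
    (HSInt.mk s hs).toCLM = s := rfl

theorem HSInt.equivariant (s : HSInt ρ π) (g : G) (ζ : V) :
    s.toCLM (ρ g ζ) = π g (s.toCLM ζ) := s.2 g ζ

theorem HSInt.toCLM_injective :
    Function.Injective (HSInt.toCLM : HSInt ρ π → (V →L[ℂ] H)) := Subtype.val_injective

@[ext]
theorem HSInt.ext {s t : HSInt ρ π} (h : ∀ ζ, s.toCLM ζ = t.toCLM ζ) : s = t :=
  HSInt.toCLM_injective (ContinuousLinearMap.ext h)

variable [FiniteDimensional ℂ V] [CompleteSpace H]

/-- The Hilbert--Schmidt inner product `trace (a* b)` of two linear maps. -/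
def hsInner (a b : V →L[ℂ] H) : ℂ :=
  haveI : CompleteSpace V := FiniteDimensional.complete ℂ V
  LinearMap.trace ℂ V ((ContinuousLinearMap.adjoint a ∘L b : V →L[ℂ] V) : V →ₗ[ℂ] V)

theorem hsInner_eq_sum (a b : V →L[ℂ] H) {ι : Type*} [Fintype ι]
    (e : OrthonormalBasis ι ℂ V) :
    hsInner a b = ∑ i, ⟪a (e i), b (e i)⟫_ℂ := by
  have : CompleteSpace V := FiniteDimensional.complete ℂ V
  rw [hsInner, LinearMap.trace_eq_sum_inner _ e]
  simp [ContinuousLinearMap.adjoint_inner_right]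

theorem hsInner_self (a : V →L[ℂ] H) {ι : Type*} [Fintype ι]
    (e : OrthonormalBasis ι ℂ V) :
    hsInner a a = ((∑ i, ‖a (e i)‖ ^ 2 : ℝ) : ℂ) := by
  rw [hsInner_eq_sum a a e]
  push_cast
  exact Finset.sum_congr rfl fun i _ => by rw [inner_self_eq_norm_sq_to_K]; rfl

instance HSInt.core : InnerProductSpace.Core ℂ (HSInt ρ π) where
  inner a b := hsInner a.toCLM b.toCLM
  conj_inner_symm a b := by
    simp only [hsInner_eq_sum _ _ (stdOrthonormalBasis ℂ V), map_sum, inner_conj_symm]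
  re_inner_nonneg a := by
    rw [hsInner_self _ (stdOrthonormalBasis ℂ V), RCLike.re_to_complex, Complex.ofReal_re]
    positivity
  add_left a b c := by
    simp only [hsInner_eq_sum _ _ (stdOrthonormalBasis ℂ V), map_add,
      add_apply, inner_add_left, Finset.sum_add_distrib]
  smul_left a b c := by
    simp only [hsInner_eq_sum _ _ (stdOrthonormalBasis ℂ V), map_smul,
      smul_apply, inner_smul_left, Finset.mul_sum]
  definite a h := by
    rw [hsInner_self _ (stdOrthonormalBasis ℂ V), Complex.ofReal_eq_zero,
      Finset.sum_eq_zero_iff_of_nonneg (fun _ _ => by positivity)] at h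
    apply HSInt.toCLM_injective
    rw [map_zero]
    apply ContinuousLinearMap.coe_injective
    refine (stdOrthonormalBasis ℂ V).toBasis.ext fun i => ?_
    have := h i (Finset.mem_univ i)
    simpa using this

instance : NormedAddCommGroup (HSInt ρ π) := HSInt.core.toNormedAddCommGroup

instance : InnerProductSpace ℂ (HSInt ρ π) := InnerProductSpace.ofCore HSInt.core.toCore

theorem HSInt.inner_def (a b : HSInt ρ π) :
    ⟪a, b⟫_ℂ = hsInner a.toCLM b.toCLM := rfl

theorem HSInt.norm_sq (a : HSInt ρ π) {ι : Type*} [Fintype ι]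
    (e : OrthonormalBasis ι ℂ V) : ‖a‖ ^ 2 = ∑ i, ‖a.toCLM (e i)‖ ^ 2 := by
  have h := hsInner_self a.toCLM e
  rw [← HSInt.inner_def, inner_self_eq_norm_sq_to_K] at h
  exact Complex.ofReal_injective ((Complex.ofReal_pow _ _).trans h)

/-- Coordinates with respect to an orthonormal basis, as a linear isometry. -/
def HSInt.coords : HSInt ρ π →ₗᵢ[ℂ]
    PiLp 2 (fun _ : Fin (Module.finrank ℂ V) => H) where
  toFun a := WithLp.toLp 2 fun i => a.toCLM (stdOrthonormalBasis ℂ V i)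
  map_add' a b := by ext i; simp
  map_smul' c a := by ext i; simp
  norm_map' a := by
    rw [← sq_eq_sq₀ (norm_nonneg _) (norm_nonneg _), a.norm_sq (stdOrthonormalBasis ℂ V),
      PiLp.norm_sq_eq_of_L2]
    rfl

instance : CompleteSpace (HSInt ρ π) := by
  let e := stdOrthonormalBasis ℂ V
  have hr : Set.range (HSInt.coords : HSInt ρ π →ₗᵢ[ℂ] _) =
      ⋂ g, ⋂ ζ, {f | ∑ i, ⟪e i, ρ g ζ⟫_ℂ • f i = π g (∑ i, ⟪e i, ζ⟫_ℂ • f i)} := by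
    ext f
    simp only [Set.mem_range, Set.mem_iInter, Set.mem_ofPred_eq]
    constructor
    · rintro ⟨a, rfl⟩ g ζ
      have key : ∀ η, ∑ i, ⟪e i, η⟫_ℂ • (HSInt.coords a) i = a.toCLM η := by
        intro η
        conv_rhs => rw [← e.sum_repr' η, map_sum]
        simp only [map_smul]
        rfl
      rw [key, key, a.equivariant]
    · intro hf
      let s : V →L[ℂ] H := ∑ i, (innerSL ℂ (e i)).smulRight (f i)
      have hs : ∀ η, s η = ∑ i, ⟪e i, η⟫_ℂ • f i := fun η => by
        simp [s]
      refine ⟨HSInt.mk s fun g ζ => by rw [hs, hs, hf], ?_⟩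
      ext j
      change s (e j) = f j
      rw [hs]
      simp [e.inner_eq_ite]
  have hc : IsClosed (Set.range (HSInt.coords : HSInt ρ π →ₗᵢ[ℂ] _)) := by
    rw [hr]
    refine isClosed_iInter fun g => isClosed_iInter fun ζ => isClosed_eq ?_ ?_
    · fun_prop
    · exact (π g).continuous.comp (by fun_prop)
  exact (completeSpace_iff_isComplete_range
    (HSInt.coords (ρ := ρ) (π := π)).isometry.isUniformInducing).2 hc.isComplete

/-- Left composition `s ↦ t ∘ s` by an operator `t` that commutes with `π`. -/
def HSInt.compLeft (t : H →L[ℂ] H) (ht : ∀ g ξ, t (π g ξ) = π g (t ξ)) :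
    HSInt ρ π →L[ℂ] HSInt ρ π :=
  LinearMap.mkContinuous
    { toFun := fun s => HSInt.mk (t ∘L s.toCLM) fun g ζ => by simp [s.equivariant, ht]
      map_add' := fun a b => HSInt.ext fun ζ => map_add t (a.toCLM ζ) (b.toCLM ζ)
      map_smul' := fun c a => HSInt.ext fun ζ => map_smul t c (a.toCLM ζ) } ‖t‖ (by
    intro s
    rw [← sq_le_sq₀ (norm_nonneg _) (by positivity), mul_pow,
      HSInt.norm_sq _ (stdOrthonormalBasis ℂ V), HSInt.norm_sq _ (stdOrthonormalBasis ℂ V),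
      Finset.mul_sum]
    refine Finset.sum_le_sum fun i _ => ?_
    rw [← mul_pow]
    exact pow_le_pow_left₀ (norm_nonneg _) (t.le_opNorm _) 2)

@[simp]
theorem HSInt.toCLM_compLeft (t : H →L[ℂ] H) (ht : ∀ g ξ, t (π g ξ) = π g (t ξ))
    (s : HSInt ρ π) : (HSInt.compLeft t ht s).toCLM = t ∘L s.toCLM := rfl

theorem HSInt.adjoint_compLeft (t : H →L[ℂ] H) (ht : ∀ g ξ, t (π g ξ) = π g (t ξ))
    (ht' : ∀ g ξ, ContinuousLinearMap.adjoint t (π g ξ) = π g (ContinuousLinearMap.adjoint t ξ)) :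
    (HSInt.compLeft (ContinuousLinearMap.adjoint t) ht' : HSInt ρ π →L[ℂ] HSInt ρ π) =
      ContinuousLinearMap.adjoint (HSInt.compLeft t ht) := by
  rw [ContinuousLinearMap.eq_adjoint_iff]
  intro s₁ s₂
  have h : hsInner (HSInt.compLeft (ContinuousLinearMap.adjoint t) ht' s₁).toCLM s₂.toCLM =
      hsInner s₁.toCLM (HSInt.compLeft t ht s₂).toCLM := by
    rw [hsInner_eq_sum _ _ (stdOrthonormalBasis ℂ V), hsInner_eq_sum _ _ (stdOrthonormalBasis ℂ V)]
    refine Finset.sum_congr rfl fun i _ => ?_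
    rw [HSInt.toCLM_compLeft, HSInt.toCLM_compLeft]
    exact ContinuousLinearMap.adjoint_inner_left t _ _
  exact h

end HS

/-! ## Compact operators -/

section Compacts

variable {H : Type w} [NormedAddCommGroup H] [InnerProductSpace ℂ H] [CompleteSpace H]

theorem isCompactOperator_adjoint {T : H →L[ℂ] H} (hT : IsCompactOperator T) :
    IsCompactOperator (ContinuousLinearMap.adjoint T) := by
  have hS : IsCompactOperator (T ∘L ContinuousLinearMap.adjoint T) := hT.comp_clm _
  set B : Set H := Metric.closedBall 0 1 with hB
  have hSB : TotallyBounded ((T ∘L ContinuousLinearMap.adjoint T) '' B) :=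
    (IsCompactOperator.isCompact_closure_image_closedBall
      (f := ((T ∘L ContinuousLinearMap.adjoint T : H →L[ℂ] H) : H →ₗ[ℂ] H))
      hS 1).totallyBounded.subset subset_closure
  refine (isCompactOperator_iff_isCompact_closure_image_closedBall
    ((ContinuousLinearMap.adjoint T : H →L[ℂ] H) : H →ₗ[ℂ] H) one_pos).2 ?_
  refine (TotallyBounded.closure ?_).isCompact_of_isClosed isClosed_closure
  rw [Metric.totallyBounded_iff]
  intro ε hε
  obtain ⟨t, htB, htf, ht⟩ :=
    Metric.finite_approx_of_totallyBounded hSB (ε ^ 2 / 2) (by positivity)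
  have htB' : ∀ y ∈ t, ∃ z, z ∈ B ∧ (T ∘L ContinuousLinearMap.adjoint T) z = y := fun y hy =>
    htB hy
  choose! f hf' using htB'
  have hfB : ∀ y ∈ t, f y ∈ B := fun y hy => (hf' y hy).1
  have hf : ∀ y ∈ t, (T ∘L ContinuousLinearMap.adjoint T) (f y) = y := fun y hy => (hf' y hy).2
  refine ⟨(fun y => ContinuousLinearMap.adjoint T (f y)) '' t, htf.image _, ?_⟩
  rintro _ ⟨x, hx, rfl⟩
  obtain ⟨y, hy, hxy⟩ := Set.mem_iUnion₂.1 (ht ⟨x, hx, rfl⟩)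
  refine Set.mem_iUnion₂.2 ⟨_, ⟨y, hy, rfl⟩, ?_⟩
  rw [Metric.mem_ball, dist_eq_norm] at hxy ⊢
  have hx1 : ‖x‖ ≤ 1 := by simpa [hB] using hx
  have hy1 : ‖f y‖ ≤ 1 := by simpa [hB] using hfB y hy
  have h2 : ‖x - f y‖ ≤ 2 := (norm_sub_le _ _).trans (by linarith)
  rw [← hf y hy, ← map_sub] at hxy
  have h3 : ‖ContinuousLinearMap.adjoint T (x - f y)‖ ^ 2 < ε ^ 2 := by
    calc ‖ContinuousLinearMap.adjoint T (x - f y)‖ ^ 2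
        = RCLike.re ⟪(T ∘L ContinuousLinearMap.adjoint T) (x - f y), x - f y⟫_ℂ := by
          rw [← inner_self_eq_norm_sq (𝕜 := ℂ), ContinuousLinearMap.adjoint_inner_right]
          rfl
      _ ≤ ‖(T ∘L ContinuousLinearMap.adjoint T) (x - f y)‖ * ‖x - f y‖ := re_inner_le_norm _ _
      _ ≤ ‖(T ∘L ContinuousLinearMap.adjoint T) (x - f y)‖ * 2 := by gcongr
      _ < ε ^ 2 := by linarith
  have h4 := lt_of_pow_lt_pow_left₀ 2 hε.le h3
  rw [map_sub] at h4
  exact h4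

variable (H) in
/-- The closed `*`-subalgebra of compact operators on `H`. -/
def compactOps : NonUnitalStarSubalgebra ℂ (H →L[ℂ] H) where
  carrier := {T | IsCompactOperator T}
  add_mem' := fun ha hb => ha.add hb
  zero_mem' := isCompactOperator_zero
  mul_mem' := fun {a b} ha _ => IsCompactOperator.comp_clm (f := a) ha b
  smul_mem' := fun c _ ha => ha.smul c
  star_mem' := fun ha => isCompactOperator_adjoint ha

instance : IsClosed (compactOps H : Set (H →L[ℂ] H)) := isClosed_setOfPred_isCompactOperator

variable (H) in
/-- The `C*`-algebra `K(H)` of compact operators on `H`, with the operator norm. -/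
def KOp : Type w := compactOps H

instance : NonUnitalCStarAlgebra (KOp H) :=
  inferInstanceAs (NonUnitalCStarAlgebra (compactOps H))

/-- The inclusion of `K(H)` in `B(H)`. -/
def KOp.toCLM : KOp H →⋆ₙₐ[ℂ] (H →L[ℂ] H) where
  toFun k := k.1
  map_smul' _ _ := rfl
  map_zero' := rfl
  map_add' _ _ := rfl
  map_mul' _ _ := rfl
  map_star' _ := rfl

theorem KOp.isCompactOperator (k : KOp H) : IsCompactOperator k.toCLM := k.2

theorem KOp.toCLM_injective : Function.Injective (KOp.toCLM : KOp H → (H →L[ℂ] H)) :=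
  Subtype.val_injective

theorem KOp.norm_toCLM (k : KOp H) : ‖k.toCLM‖ = ‖k‖ := rfl

/-- A compact operator, as an element of `K(H)`. -/
def KOp.mk (T : H →L[ℂ] H) (hT : IsCompactOperator T) : KOp H := ⟨T, hT⟩

@[simp]
theorem KOp.toCLM_mk (T : H →L[ℂ] H) (hT : IsCompactOperator T) : (KOp.mk T hT).toCLM = T := rfl

end Compacts

/-! ## Actions of a finite group on `(X, H)` and the algebra `C₀(X, K(H))^W` -/

section Actions

variable (W : Type u) [Group W] (X : Type v) [TopologicalSpace X] [MulAction W X]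
  (H : Type w) [NormedAddCommGroup H] [InnerProductSpace ℂ H]

/-- An action of `W` on `(X, H)`: an action of `W` on `X × H` by homeomorphisms that covers the
given action on `X`, and for which the induced maps `I w x : H → H` between the fibres over `x`
and `w • x` are unitary linear operators. -/
structure BundleAction where
  act : W →* ((X × H) ≃ₜ (X × H))
  I : W → X → (H ≃ₗᵢ[ℂ] H)
  act_apply : ∀ w x ξ, act w (x, ξ) = (w • x, I w x ξ)

variable {W X H}

theorem BundleAction.I_mul (I : BundleAction W X H) (w₁ w₂ : W) (x : X) :
    I.I (w₁ * w₂) x = I.I w₁ (w₂ • x) * I.I w₂ x := by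
  ext ξ
  have h : I.act (w₁ * w₂) (x, ξ) = I.act w₁ (I.act w₂ (x, ξ)) := by
    rw [map_mul]; rfl
  simp only [I.act_apply] at h
  exact congrArg Prod.snd h

theorem BundleAction.I_one (I : BundleAction W X H) (x : X) : I.I 1 x = 1 := by
  have h := I.I_mul 1 1 x
  rw [mul_one, one_smul] at h
  exact left_eq_mul.1 h

/-- The unitary representation `I_x : w ↦ I w x` of the isotropy group `W_x` on `H`. -/
def BundleAction.isotropyRep (I : BundleAction W X H) (x : X) :
    MulAction.stabilizer W x →* (H ≃ₗᵢ[ℂ] H) where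
  toFun g := I.I g x
  map_one' := I.I_one x
  map_mul' g₁ g₂ := by
    have h : (g₂ : W) • x = x := g₂.2
    rw [Subgroup.coe_mul, I.I_mul, h]

theorem BundleAction.I_inv (I : BundleAction W X H) (w : W) (x : X) :
    I.I w⁻¹ x = (I.I w (w⁻¹ • x))⁻¹ := by
  have h := I.I_mul w w⁻¹ x
  rw [mul_inv_cancel, I.I_one] at h
  exact (inv_eq_of_mul_eq_one_right h.symm).symm

variable [CompleteSpace H]

/-- The function `α_w(k) : x ↦ I_{w, w⁻¹x} k(w⁻¹x) I_{w⁻¹, x}`. -/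
def BundleAction.alpha (I : BundleAction W X H) (w : W) (k : C₀(X, KOp H)) (x : X) :
    H →L[ℂ] H :=
  (I.I w (w⁻¹ • x) : H →L[ℂ] H) ∘L (k (w⁻¹ • x)).toCLM ∘L (I.I w⁻¹ x : H →L[ℂ] H)

theorem BundleAction.alpha_apply (I : BundleAction W X H) (w : W) (k : C₀(X, KOp H))
    (x : X) (ξ : H) : I.alpha w k x ξ =
      I.I w (w⁻¹ • x) ((k (w⁻¹ • x)).toCLM ((I.I w (w⁻¹ • x)).symm ξ)) := by
  rw [BundleAction.alpha, I.I_inv]; rfl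

/-- The fixed-point algebra `C₀(X, K(H))^W` of the action `α`. -/
def BundleAction.fixedAlgebra (I : BundleAction W X H) :
    NonUnitalStarSubalgebra ℂ C₀(X, KOp H) where
  carrier := {k | ∀ w x, I.alpha w k x = (k x).toCLM}
  add_mem' := by
    intro a b ha hb w x
    ext ξ
    have h1 := congr($(ha w x) ξ)
    have h2 := congr($(hb w x) ξ)
    rw [I.alpha_apply] at h1 h2 ⊢
    simp [h1, h2]
  zero_mem' := by
    intro w x
    ext ξ
    rw [I.alpha_apply]
    simp
  mul_mem' := by
    intro a b ha hb w x
    ext ξ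
    have h2 := congr($(hb w x) ξ)
    have h1 := congr($(ha w x) ((b x).toCLM ξ))
    rw [I.alpha_apply] at h1 h2 ⊢
    change _ = (a x).toCLM ((b x).toCLM ξ)
    rw [← h1, ← h2]
    simp
  smul_mem' := by
    intro c a ha w x
    ext ξ
    have h1 := congr($(ha w x) ξ)
    rw [I.alpha_apply] at h1 ⊢
    simp [h1]
  star_mem' := by
    intro a ha w x
    ext ξ
    refine ext_inner_left ℂ fun η => ?_
    have h1 := congr($(ha w x) η)
    rw [I.alpha_apply] at h1 ⊢
    change ⟪η, I.I w (w⁻¹ • x) (ContinuousLinearMap.adjoint (a (w⁻¹ • x)).toCLM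
      ((I.I w (w⁻¹ • x)).symm ξ))⟫_ℂ = ⟪η, ContinuousLinearMap.adjoint (a x).toCLM ξ⟫_ℂ
    rw [ContinuousLinearMap.adjoint_inner_right, ← h1,
      ← LinearIsometryEquiv.inner_map_map (I.I w (w⁻¹ • x)).symm,
      LinearIsometryEquiv.symm_apply_apply, ContinuousLinearMap.adjoint_inner_right,
      ← LinearIsometryEquiv.inner_map_map (I.I w (w⁻¹ • x)),
      LinearIsometryEquiv.apply_symm_apply]

theorem BundleAction.fixedAlgebra_commute (I : BundleAction W X H) (k : I.fixedAlgebra) (x : X)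
    (g : MulAction.stabilizer W x) (ξ : H) :
    ((k : C₀(X, KOp H)) x).toCLM (I.isotropyRep x g ξ) =
      I.isotropyRep x g (((k : C₀(X, KOp H)) x).toCLM ξ) := by
  have h := congr($(k.2 (g : W) x) (I.isotropyRep x g ξ))
  have hg : (g : W)⁻¹ • x = x := by
    rw [inv_smul_eq_iff]; exact g.2.symm
  rw [I.alpha_apply, hg] at h
  rw [← h]
  change I.I g x _ = I.I g x _
  congr 2
  exact (I.I g x).symm_apply_apply ξ

variable [Finite W]

/-- The representation `π_{x, ρ}` of `C₀(X, K(H))^W` on `HS(ρ, I_x)^{W_x}`, `k ↦ (s ↦ k(x) ∘ s)`. -/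
def BundleAction.rep (I : BundleAction W X H) (x : X)
    (ρ : UnitaryIrrep.{u, r} (MulAction.stabilizer W x)) :
    I.fixedAlgebra →⋆ₙₐ[ℂ]
      (HSInt ρ.hom (I.isotropyRep x) →L[ℂ] HSInt ρ.hom (I.isotropyRep x)) where
  toFun k := HSInt.compLeft ((k : C₀(X, KOp H)) x).toCLM
    (I.fixedAlgebra_commute k x)
  map_smul' c k := by
    ext s ζ
    rfl
  map_zero' := by
    ext s ζ
    rfl
  map_add' a b := by
    ext s ζ
    rfl
  map_mul' a b := by
    ext s ζ
    rfl
  map_star' a := HSInt.adjoint_compLeft _ (I.fixedAlgebra_commute a x)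
    (I.fixedAlgebra_commute (star a) x)

theorem BundleAction.rep_apply (I : BundleAction W X H) (x : X)
    (ρ : UnitaryIrrep.{u, r} (MulAction.stabilizer W x)) (k : I.fixedAlgebra)
    (s : HSInt ρ.hom (I.isotropyRep x)) :
    (I.rep x ρ k s).toCLM = ((k : C₀(X, KOp H)) x).toCLM ∘L s.toCLM := rfl

/-- Equivalent `ρ` give equivalent `π_{x, ρ}`. -/
theorem BundleAction.rep_congr (I : BundleAction W X H) (x : X)
    (ρ₁ ρ₂ : UnitaryIrrep.{u, r} (MulAction.stabilizer W x)) (h : ρ₁.Equiv ρ₂) :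
    RepEquiv (I.rep x ρ₁) (I.rep x ρ₂) := by
  obtain ⟨t, ht⟩ := h
  have ht' : ∀ g ζ, t.symm (ρ₂.hom g ζ) = ρ₁.hom g (t.symm ζ) := fun g ζ => by
    rw [LinearIsometryEquiv.symm_apply_eq, ht, LinearIsometryEquiv.apply_symm_apply]
  let e : HSInt ρ₁.hom (I.isotropyRep x) ≃ₗ[ℂ] HSInt ρ₂.hom (I.isotropyRep x) :=
    { toFun := fun s => HSInt.mk (s.toCLM ∘L (t.symm : ρ₂.carrier →L[ℂ] ρ₁.carrier))
        fun g ζ => by simp [ht', s.equivariant]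
      invFun := fun s => HSInt.mk (s.toCLM ∘L (t : ρ₁.carrier →L[ℂ] ρ₂.carrier))
        fun g ζ => by simp [ht, s.equivariant]
      map_add' := fun a b => rfl
      map_smul' := fun c a => rfl
      left_inv := fun s => HSInt.ext fun ζ => congrArg s.toCLM (t.symm_apply_apply ζ)
      right_inv := fun s => HSInt.ext fun ζ => congrArg s.toCLM (t.apply_symm_apply ζ) }
  refine ⟨⟨e, fun s => ?_⟩, fun a s => rfl⟩
  rw [← sq_eq_sq₀ (norm_nonneg _) (norm_nonneg _),
    HSInt.norm_sq _ ((stdOrthonormalBasis ℂ ρ₁.carrier).map t),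
    HSInt.norm_sq _ (stdOrthonormalBasis ℂ ρ₁.carrier)]
  refine Finset.sum_congr rfl fun i _ => ?_
  have h : (e s).toCLM (t (stdOrthonormalBasis ℂ ρ₁.carrier i)) =
      s.toCLM (stdOrthonormalBasis ℂ ρ₁.carrier i) :=
    congrArg s.toCLM (t.symm_apply_apply _)
  rw [OrthonormalBasis.map_apply, h]

/-- For `x₂ = w • x₁`, the isomorphism `W_{x₂} → W_{x₁}`, `v ↦ w⁻¹ v w`. -/
def stabilizerConj (w : W) {x₁ x₂ : X} (h : x₂ = w • x₁) :
    MulAction.stabilizer W x₂ ≃* MulAction.stabilizer W x₁ where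
  toFun v := ⟨w⁻¹ * v * w, by
    have := v.2
    rw [MulAction.mem_stabilizer_iff] at this ⊢
    rw [mul_smul, mul_smul, ← h, this, h, inv_smul_smul]⟩
  invFun v := ⟨w * v * w⁻¹, by
    have := v.2
    rw [MulAction.mem_stabilizer_iff] at this ⊢
    rw [mul_smul, mul_smul, h, inv_smul_smul, this]⟩
  left_inv v := by ext; simp [mul_assoc]
  right_inv v := by ext; simp [mul_assoc]
  map_mul' v₁ v₂ := by ext; simp [mul_assoc]

/-- For `x₂ = w • x₁` and an irreducible representation `ρ` of `W_{x₁}`, the irreducible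
representation `wρ : v ↦ ρ (w⁻¹ v w)` of `W_{x₂}`. -/
def conjIrrep (w : W) {x₁ x₂ : X} (h : x₂ = w • x₁)
    (ρ : UnitaryIrrep.{u, r} (MulAction.stabilizer W x₁)) :
    UnitaryIrrep.{u, r} (MulAction.stabilizer W x₂) where
  carrier := ρ.carrier
  hom := ρ.hom.comp (stabilizerConj w h).toMonoidHom
  irreducible := ⟨ρ.irreducible.1, fun S hS hinv => ρ.irreducible.2 S hS fun g ξ hξ => by
    have := hinv ((stabilizerConj w h).symm g) ξ hξ
    simpa using this⟩

/-- The map `[ρ] ↦ [π_{x, ρ}]` on equivalence classes. -/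
def BundleAction.repClass (I : BundleAction W X H) (x : X) :
    UnitaryDual.{u, r} (MulAction.stabilizer W x) →
      RepClass.{max v w, max r w} I.fixedAlgebra :=
  Quotient.map (fun ρ => ⟨HSInt ρ.hom (I.isotropyRep x), I.rep x ρ⟩)
    fun ρ₁ ρ₂ h => I.rep_congr x ρ₁ ρ₂ h

/-- Given a choice `c` of a point in each orbit, the set of pairs `(o, [ρ])` where `o` is an orbit
and `[ρ]` is the class of an irreducible representation of the isotropy group of the point `c o`
that occurs in `I_{c o}`. -/
def BundleAction.orbitPairs (I : BundleAction W X H)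
    (c : MulAction.orbitRel.Quotient W X → X) :
    Set (Σ o : MulAction.orbitRel.Quotient W X,
      UnitaryDual.{u, r} (MulAction.stabilizer W (c o))) :=
  {p | ∃ ρ : UnitaryIrrep.{u, r} (MulAction.stabilizer W (c p.1)),
    Occurs ρ.hom (I.isotropyRep (c p.1)) ∧ Quotient.mk _ ρ = p.2}

end Actions

end

end EquivariantCompacts

namespace EquivariantCompacts

noncomputable section

/-! An element of the fixed-point algebra `A` takes at `x` a value in `K(H)^{W_x}`, the compact
operators commuting with `I_x`. The theorem reduces to the representation theory of this algebra.

Let `π` be a unitary representation on `H` of a finite group `G`, and `ρ` an irreducible one.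
Schur's lemma says that `r* s` is the scalar `⟪r, s⟫ / dim ρ` for intertwiners `r, s : ρ → π`. So
the operators `t s*` multiply like matrix units: they carry any nonzero vector of `HS(ρ, π)^G` to
any other, and if a representation `σ` of `K(H)^G` does not kill `s s*`, then `t ↦ σ(t s*) ξ` embeds
`HS(ρ, π)^G` up to scale in the space of `σ`, for a suitable `ξ`. Such `ρ` and `s` exist because
equivariant compact operators are limits of their compressions to finite-dimensional invariant
subspaces, and one of least dimension whose projection survives under `σ` is irreducible
(`exists_repEquiv_hsRep`).

Averaging a bump function over `W` extends every element of `K(H)^{W_x}` to an element of `A`, which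
can be made to vanish at given points off the orbit (`BundleAction.exists_fixedAlgebra_apply_eq`).
Hence evaluation at `x` is onto `K(H)^{W_x}`, each `π_{x, ρ}` is irreducible, and different orbits
give inequivalent representations.

Conversely, the kernel of an irreducible representation of `A` is prime, and a compactness argument
shows that it contains the kernel of evaluation at some point
(`BundleAction.exists_forall_eq_zero`). Along an orbit, `s ↦ I_{g,x} s` identifies `π_{x, ρ}` with
`π_{gx, gρ}`; at one point, `s* t` is a nonzero intertwiner between `ρ`'s whose representations are
equivalent. -/

theorem adjoint_equivariant {G : Type u} [Group G]
    {V : Type r} [NormedAddCommGroup V] [InnerProductSpace ℂ V] [CompleteSpace V]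
    {H : Type w} [NormedAddCommGroup H] [InnerProductSpace ℂ H] [CompleteSpace H]
    {ρ : G →* (V ≃ₗᵢ[ℂ] V)} {π : G →* (H ≃ₗᵢ[ℂ] H)}
    {s : V →L[ℂ] H} (hs : ∀ g ζ, s (ρ g ζ) = π g (s ζ)) (g : G) (ξ : H) :
    ContinuousLinearMap.adjoint s (π g ξ) = ρ g (ContinuousLinearMap.adjoint s ξ) := by
  refine ext_inner_left ℂ fun ζ => ?_
  obtain ⟨ζ, rfl⟩ := (ρ g).surjective ζ
  rw [ContinuousLinearMap.adjoint_inner_right, hs, LinearIsometryEquiv.inner_map_map,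
    LinearIsometryEquiv.inner_map_map, ContinuousLinearMap.adjoint_inner_right]

/-! ### Schur's lemma and products of intertwiners. -/

section Schur

variable {G : Type u} [Group G]
  {V : Type r} [NormedAddCommGroup V] [InnerProductSpace ℂ V] [FiniteDimensional ℂ V]

/-- Schur's lemma: an operator commuting with an irreducible representation is a scalar. -/
theorem IsIrreducibleUnitary.exists_eq_smul {ρ : G →* (V ≃ₗᵢ[ℂ] V)}
    (h : IsIrreducibleUnitary ρ) (a : V →L[ℂ] V) (ha : ∀ g ζ, a (ρ g ζ) = ρ g (a ζ)) :
    ∃ c : ℂ, a = c • ContinuousLinearMap.id ℂ V := by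
  obtain ⟨hn, h⟩ := h
  obtain ⟨c, hc⟩ := Module.End.exists_eigenvalue (a : V →ₗ[ℂ] V)
  refine ⟨c, ?_⟩
  let S := Module.End.eigenspace (a : V →ₗ[ℂ] V) c
  have hS : ∀ ξ, ξ ∈ S ↔ a ξ = c • ξ := fun ξ => Module.End.mem_eigenspace_iff
  rcases h S S.closed_of_finiteDimensional (fun g ξ hξ => by
    rw [hS] at hξ ⊢
    rw [ha, hξ, map_smul]) with h0 | h1
  · exact absurd h0 hc
  · ext ξ
    have : ξ ∈ S := h1 ▸ Submodule.mem_top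
    simpa using (hS ξ).1 this

variable [CompleteSpace V] {H : Type w} [NormedAddCommGroup H] [InnerProductSpace ℂ H]
  [CompleteSpace H] {ρ : G →* (V ≃ₗᵢ[ℂ] V)} {π : G →* (H ≃ₗᵢ[ℂ] H)}

/-- For intertwiners `r, s` from an irreducible representation, `r* s` is the scalar
`⟪r, s⟫ / dim V`. -/
theorem HSInt.adjoint_comp (h : IsIrreducibleUnitary ρ) (r s : HSInt ρ π) :
    ContinuousLinearMap.adjoint r.toCLM ∘L s.toCLM =
      (⟪r, s⟫_ℂ / Module.finrank ℂ V) • ContinuousLinearMap.id ℂ V := by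
  obtain ⟨c, hc⟩ := h.exists_eq_smul (ContinuousLinearMap.adjoint r.toCLM ∘L s.toCLM)
    fun g ζ => by
      rw [ContinuousLinearMap.comp_apply, s.equivariant, adjoint_equivariant r.equivariant]
      rfl
  have := h.1
  have hd : (Module.finrank ℂ V : ℂ) ≠ 0 := by
    exact_mod_cast (Module.finrank_pos (R := ℂ) (M := V)).ne'
  -- The scalar is found by taking traces: `trace (r* s) = c · dim V`.
  have h1 : ⟪r, s⟫_ℂ = c * Module.finrank ℂ V := by
    rw [HSInt.inner_def, hsInner, hc]
    simp
  rw [hc, h1, mul_div_cancel_right₀ _ hd]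

theorem HSInt.adjoint_apply_apply (h : IsIrreducibleUnitary ρ) (r s : HSInt ρ π) (ζ : V) :
    ContinuousLinearMap.adjoint r.toCLM (s.toCLM ζ) =
      (⟪r, s⟫_ℂ / Module.finrank ℂ V) • ζ :=
  congr($(HSInt.adjoint_comp h r s) ζ)

end Schur

theorem isCompactOperator_of_finiteDimensional
    {V : Type r} [NormedAddCommGroup V] [NormedSpace ℂ V] [FiniteDimensional ℂ V]
    {H : Type w} [NormedAddCommGroup H] [NormedSpace ℂ H] (t : V →L[ℂ] H) :
    IsCompactOperator t := by
  have : ProperSpace V := FiniteDimensional.proper ℂ V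
  exact ⟨t '' Metric.closedBall 0 1, (isCompact_closedBall 0 1).image t.continuous,
    Filter.mem_of_superset (Metric.closedBall_mem_nhds 0 one_pos) (Set.subset_preimage_image _ _)⟩

/-- An irreducible representation that occurs in `π` has a nonzero intertwiner to `π`. -/
theorem Occurs.exists_intertwiner {G : Type u} [Group G]
    {V : Type r} [NormedAddCommGroup V] [InnerProductSpace ℂ V]
    {H : Type w} [NormedAddCommGroup H] [InnerProductSpace ℂ H]
    {ρ : G →* (V ≃ₗᵢ[ℂ] V)} {π : G →* (H ≃ₗᵢ[ℂ] H)}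
    (h : IsIrreducibleUnitary ρ) (ho : Occurs ρ π) :
    ∃ s : HSInt ρ π, s ≠ 0 := by
  obtain ⟨t, ht⟩ := ho
  have := h.1
  obtain ⟨ζ, hζ⟩ := exists_ne (0 : V)
  refine ⟨HSInt.mk t.toContinuousLinearMap ht, fun h0 => hζ ?_⟩
  have : t ζ = 0 := congr(HSInt.toCLM $h0 ζ)
  rwa [← map_zero t, t.injective.eq_iff] at this

/-! ### The algebra `K(H)^G` and its representations on `HS(ρ, π)^G`. -/

section GroupLevel

variable {G : Type u} [Group G]
  {H : Type w} [NormedAddCommGroup H] [InnerProductSpace ℂ H] [CompleteSpace H]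

/-- The `C*`-algebra `K(H)^G` of compact operators that commute with a unitary representation. -/
def equivariantCompacts (π : G →* (H ≃ₗᵢ[ℂ] H)) : NonUnitalStarSubalgebra ℂ (H →L[ℂ] H) where
  carrier := {T | IsCompactOperator T ∧ ∀ g ξ, T (π g ξ) = π g (T ξ)}
  add_mem' := fun ha hb => ⟨ha.1.add hb.1, fun g ξ => by simp [ha.2, hb.2]⟩
  zero_mem' := ⟨isCompactOperator_zero, fun g ξ => by simp⟩
  mul_mem' := fun {a b} ha hb =>
    ⟨IsCompactOperator.comp_clm (f := a) ha.1 b, fun g ξ => by simp [ha.2, hb.2]⟩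
  smul_mem' := fun c _ ha => ⟨ha.1.smul c, fun g ξ => by simp [ha.2]⟩
  star_mem' := fun ha => ⟨isCompactOperator_adjoint ha.1, adjoint_equivariant ha.2⟩

variable {π : G →* (H ≃ₗᵢ[ℂ] H)}

theorem mem_equivariantCompacts {T : H →L[ℂ] H} :
    T ∈ equivariantCompacts π ↔ IsCompactOperator T ∧ ∀ g ξ, T (π g ξ) = π g (T ξ) := Iff.rfl

theorem isClosed_equivariantCompacts : IsClosed (equivariantCompacts π : Set (H →L[ℂ] H)) := by
  have h : (equivariantCompacts π : Set (H →L[ℂ] H)) = {T : H →L[ℂ] H | IsCompactOperator T} ∩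
      ⋂ g, ⋂ ξ, {T : H →L[ℂ] H | T (π g ξ) = π g (T ξ)} := by
    ext T
    simp [mem_equivariantCompacts]
  rw [h]
  refine isClosed_setOfPred_isCompactOperator.inter
    (isClosed_iInter fun g => isClosed_iInter fun ξ => isClosed_eq ?_ ?_)
  · fun_prop
  · exact (π g).continuous.comp (by fun_prop)

/-- Completeness makes every `*`-representation of `K(H)^G` contractive, which the approximation
argument in `exists_minimal_invariantProj` needs. -/
instance : NonUnitalCStarAlgebra (equivariantCompacts π) :=
  haveI : IsClosed (equivariantCompacts π : Set (H →L[ℂ] H)) := isClosed_equivariantCompacts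
  inferInstance

variable {V : Type r} [NormedAddCommGroup V] [InnerProductSpace ℂ V] [FiniteDimensional ℂ V]
  {ρ : G →* (V ≃ₗᵢ[ℂ] V)}

variable (π ρ) in
/-- The representation of `K(H)^G` on `HS(ρ, π)^G` by left composition. -/
def hsRep : equivariantCompacts π →⋆ₙₐ[ℂ] (HSInt ρ π →L[ℂ] HSInt ρ π) where
  toFun T := HSInt.compLeft T.1 T.2.2
  map_smul' _ _ := rfl
  map_zero' := rfl
  map_add' _ _ := rfl
  map_mul' _ _ := rfl
  map_star' T := HSInt.adjoint_compLeft _ T.2.2 (star T).2.2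

theorem IsIrreducibleUnitary.finrank_ne_zero (h : IsIrreducibleUnitary ρ) :
    (Module.finrank ℂ V : ℂ) ≠ 0 := by
  have := h.1
  exact_mod_cast (Module.finrank_pos (R := ℂ) (M := V)).ne'

variable [CompleteSpace V]

/-- The finite-rank operator `t s*`, for intertwiners `t` and `s`. -/
def HSInt.compAdjoint (t s : HSInt ρ π) : equivariantCompacts π :=
  ⟨t.toCLM ∘L ContinuousLinearMap.adjoint s.toCLM,
    (isCompactOperator_of_finiteDimensional t.toCLM).comp_clm _, fun g ξ => by
      simp [adjoint_equivariant s.equivariant, t.equivariant]⟩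

theorem HSInt.compAdjoint_add (t t' s : HSInt ρ π) :
    (t + t').compAdjoint s = t.compAdjoint s + t'.compAdjoint s := rfl

theorem HSInt.compAdjoint_smul (c : ℂ) (t s : HSInt ρ π) :
    (c • t).compAdjoint s = c • t.compAdjoint s := rfl

theorem HSInt.compAdjoint_hsRep (T : equivariantCompacts π) (t s : HSInt ρ π) :
    (hsRep π ρ T t).compAdjoint s = T * t.compAdjoint s := rfl

theorem HSInt.star_compAdjoint (t s : HSInt ρ π) :
    star (t.compAdjoint s) = s.compAdjoint t := by
  apply Subtype.ext
  change ContinuousLinearMap.adjoint (t.toCLM ∘L ContinuousLinearMap.adjoint s.toCLM) = _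
  rw [ContinuousLinearMap.adjoint_comp, ContinuousLinearMap.adjoint_adjoint]
  rfl

/-- The inner factor `s* t'` is a scalar by Schur, so the operators `t s*` obey the matrix-unit
relations up to the factor `dim V`. -/
theorem HSInt.compAdjoint_mul (h : IsIrreducibleUnitary ρ) (t s t' s' : HSInt ρ π) :
    t.compAdjoint s * t'.compAdjoint s' =
      (⟪s, t'⟫_ℂ / Module.finrank ℂ V) • t.compAdjoint s' := by
  apply Subtype.ext
  ext ξ
  change t.toCLM (ContinuousLinearMap.adjoint s.toCLM (t'.toCLM
    (ContinuousLinearMap.adjoint s'.toCLM ξ))) = _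
  rw [HSInt.adjoint_apply_apply h, map_smul]
  rfl

theorem hsRep_compAdjoint (h : IsIrreducibleUnitary ρ) (t s s' : HSInt ρ π) :
    hsRep π ρ (t.compAdjoint s) s' = (⟪s, s'⟫_ℂ / Module.finrank ℂ V) • t := by
  ext ζ
  change t.toCLM (ContinuousLinearMap.adjoint s.toCLM (s'.toCLM ζ)) = _
  rw [HSInt.adjoint_apply_apply h, map_smul]
  rfl

/-- Every nonzero vector is carried to every other by a multiple of some `t s*`; occurrence in `π`
only ensures that the space is nonzero. -/
theorem isIrreducibleRep_hsRep (h : IsIrreducibleUnitary ρ) (ho : Occurs ρ π) :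
    IsIrreducibleRep (hsRep π ρ) := by
  have hd := h.finrank_ne_zero
  have key : ∀ s : HSInt ρ π, s ≠ 0 → ∀ t : HSInt ρ π, ∃ T, hsRep π ρ T s = t := by
    intro s hs t
    refine ⟨(⟪s, s⟫_ℂ / Module.finrank ℂ V)⁻¹ • t.compAdjoint s, ?_⟩
    rw [map_smul, smul_apply, hsRep_compAdjoint h, smul_smul,
      inv_mul_cancel₀ (div_ne_zero (inner_self_ne_zero.2 hs) hd), one_smul]
  obtain ⟨s, hs⟩ := ho.exists_intertwiner h
  constructor
  · obtain ⟨T, hT⟩ := key s hs s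
    refine ⟨T, fun h0 => hs ?_⟩
    rw [← hT, h0, zero_apply]
  · intro S _ hS
    refine or_iff_not_imp_left.2 fun hne => ?_
    obtain ⟨t, htS, ht⟩ := S.ne_bot_iff.1 hne
    refine Submodule.eq_top_iff'.2 fun t' => ?_
    obtain ⟨T, hT⟩ := key t ht t'
    exact hT ▸ hS T t htS

end GroupLevel

theorem unitary_inv_apply_apply {G : Type u} [Group G]
    {H : Type w} [NormedAddCommGroup H] [InnerProductSpace ℂ H]
    (π : G →* (H ≃ₗᵢ[ℂ] H)) (g : G) (ξ : H) : π g⁻¹ (π g ξ) = ξ := by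
  rw [map_inv]
  exact (π g).symm_apply_apply ξ

theorem unitary_apply_inv_apply {G : Type u} [Group G]
    {H : Type w} [NormedAddCommGroup H] [InnerProductSpace ℂ H]
    (π : G →* (H ≃ₗᵢ[ℂ] H)) (g : G) (ξ : H) : π g (π g⁻¹ ξ) = ξ := by
  rw [map_inv]
  exact (π g).apply_symm_apply ξ

/-! ### Subrepresentations and finite-dimensional invariant projections. -/

section Subrepresentations

variable {G : Type u} [Group G]
  {V : Type r} [NormedAddCommGroup V] [InnerProductSpace ℂ V]
  {H : Type w} [NormedAddCommGroup H] [InnerProductSpace ℂ H]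

/-- The pull-back of a unitary representation along an isometry with invariant range. -/
def restrictUnitary (π : G →* (H ≃ₗᵢ[ℂ] H)) (j : V →ₗᵢ[ℂ] H)
    (hj : ∀ g ζ, π g (j ζ) ∈ LinearMap.range j.toLinearMap) : G →* (V ≃ₗᵢ[ℂ] V) :=
  -- The chosen preimages are unique since `j` is injective, so linearity and multiplicativity can
  -- be checked after applying `j`.
  let f : G → V → V := fun g ζ => (hj g ζ).choose
  have hf : ∀ g ζ, j (f g ζ) = π g (j ζ) := fun g ζ => (hj g ζ).choose_spec
  { toFun := fun g =>
      { toFun := f g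
        invFun := f g⁻¹
        map_add' := fun a b => j.injective (by simp [hf])
        map_smul' := fun c a => j.injective (by simp [hf])
        left_inv := fun a => j.injective (by rw [hf, hf, unitary_inv_apply_apply])
        right_inv := fun a => j.injective (by rw [hf, hf, unitary_apply_inv_apply])
        norm_map' := fun a => by
          rw [← j.norm_map]
          change ‖j (f g a)‖ = _
          rw [hf, LinearIsometryEquiv.norm_map, j.norm_map] }
    map_one' := LinearIsometryEquiv.ext fun a => j.injective (by
      change j (f 1 a) = j a
      simp [hf])
    map_mul' := fun g g' => LinearIsometryEquiv.ext fun a => j.injective (by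
      change j (f (g * g') a) = j (f g (f g' a))
      simp [hf]) }

theorem apply_restrictUnitary (π : G →* (H ≃ₗᵢ[ℂ] H)) (j : V →ₗᵢ[ℂ] H)
    (hj : ∀ g ζ, π g (j ζ) ∈ LinearMap.range j.toLinearMap) (g : G) (ζ : V) :
    j (restrictUnitary π j hj g ζ) = π g (j ζ) :=
  (hj g ζ).choose_spec

end Subrepresentations

section InvariantProjections

variable {G : Type u} [Group G]
  {H : Type w} [NormedAddCommGroup H] [InnerProductSpace ℂ H]
  {π : G →* (H ≃ₗᵢ[ℂ] H)}

theorem orthogonal_invariant {E : Submodule ℂ H} (hE : ∀ g, ∀ ξ ∈ E, π g ξ ∈ E) :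
    ∀ g, ∀ ξ ∈ Eᗮ, π g ξ ∈ Eᗮ := by
  intro g ξ hξ η hη
  rw [← LinearIsometryEquiv.inner_map_map (π g⁻¹), unitary_inv_apply_apply]
  exact hξ _ (hE _ _ hη)

variable [CompleteSpace H]

/-- The orthogonal projection to a finite-dimensional invariant subspace. -/
def invariantProj (E : Submodule ℂ H) [FiniteDimensional ℂ E]
    (hE : ∀ g, ∀ ξ ∈ E, π g ξ ∈ E) : equivariantCompacts π :=
  ⟨E.starProjection,
    (isCompactOperator_of_finiteDimensional E.subtypeL).comp_clm E.orthogonalProjectionOnto,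
    fun g ξ => Submodule.eq_starProjection_of_mem_orthogonal
      (hE g _ (E.starProjection_apply_mem ξ)) (by
        rw [← map_sub]
        exact orthogonal_invariant hE g _ (E.sub_starProjection_mem_orthogonal ξ))⟩

/-- Equivariant compact operators are approximated by their compressions to finite-dimensional
invariant subspaces. -/
theorem exists_norm_sub_invariantProj_mul_le [Finite G] (T : equivariantCompacts π) {ε : ℝ}
    (hε : 0 < ε) : ∃ (E : Submodule ℂ H) (_ : FiniteDimensional ℂ E)
      (hE : ∀ g, ∀ ξ ∈ E, π g ξ ∈ E), ‖T - invariantProj E hE * T‖ ≤ ε := by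
  have hT : TotallyBounded (T.1 '' Metric.closedBall 0 1) :=
    (IsCompactOperator.isCompact_closure_image_closedBall
      (f := (T.1 : H →ₗ[ℂ] H)) T.2.1 1).totallyBounded.subset subset_closure
  obtain ⟨t, -, htf, ht⟩ := Metric.finite_approx_of_totallyBounded hT ε hε
  have := htf.to_subtype
  -- `t` is a finite `ε`-net for the image of the unit ball; the span of its `G`-translates is
  -- invariant, and finite-dimensional because `G` is finite.
  let E : Submodule ℂ H := Submodule.span ℂ (Set.range fun p : G × t => π p.1 (p.2 : H))
  have hEf : FiniteDimensional ℂ E := FiniteDimensional.span_of_finite ℂ (Set.finite_range _)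
  have hE : ∀ g, ∀ ξ ∈ E, π g ξ ∈ E := by
    intro g
    have : E ≤ E.comap ((π g).toLinearEquiv : H →ₗ[ℂ] H) := by
      rw [Submodule.span_le]
      rintro _ ⟨⟨g', y⟩, rfl⟩
      exact Submodule.subset_span ⟨(g * g', y), by simp⟩
    exact fun ξ hξ => this hξ
  refine ⟨E, hEf, hE, ?_⟩
  change ‖T.1 - E.starProjection ∘L T.1‖ ≤ ε
  refine ContinuousLinearMap.opNorm_le_of_unit_norm hε.le fun ξ hξ => ?_
  obtain ⟨y, hy, hξy⟩ := Set.mem_iUnion₂.1 (ht ⟨ξ, by simp [hξ], rfl⟩)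
  have hyE : y ∈ E := Submodule.subset_span ⟨(1, ⟨y, hy⟩), by simp⟩
  -- The projection to `Eᗮ` kills the net point `y`, so the error is at most `‖T ξ - y‖`.
  have h1 : (T.1 - E.starProjection ∘L T.1) ξ = Eᗮ.starProjection (T.1 ξ - y) := by
    rw [map_sub, Submodule.starProjection_orthogonal_apply_eq_zero hyE,
      Submodule.starProjection_orthogonal_val]
    simp
  rw [h1]
  refine (Submodule.norm_starProjection_apply_le _ _).trans ?_
  rw [Metric.mem_ball, dist_eq_norm] at hξy
  exact hξy.le

theorem invariantProj_eq_add {E S : Submodule ℂ H} [FiniteDimensional ℂ E]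
    [FiniteDimensional ℂ S] [FiniteDimensional ℂ (Sᗮ ⊓ E : Submodule ℂ H)] (hSE : S ≤ E)
    (hE : ∀ g, ∀ ξ ∈ E, π g ξ ∈ E) (hS : ∀ g, ∀ ξ ∈ S, π g ξ ∈ S) :
    invariantProj E hE = invariantProj S hS + invariantProj (Sᗮ ⊓ E)
      fun g ξ hξ => Submodule.mem_inf.2
        ⟨orthogonal_invariant hS g ξ (Submodule.mem_inf.1 hξ).1, hE g ξ (Submodule.mem_inf.1 hξ).2⟩ := by
  apply Subtype.ext
  ext ξ
  change E.starProjection ξ = S.starProjection ξ + (Sᗮ ⊓ E).starProjection ξ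
  apply Submodule.eq_starProjection_of_mem_orthogonal
  · exact E.add_mem (hSE (S.starProjection_apply_mem ξ))
      ((Sᗮ ⊓ E).starProjection_apply_mem ξ).2
  · intro η hη
    have h1 : S.starProjection η ∈ S := S.starProjection_apply_mem η
    have h2 : η - S.starProjection η ∈ Sᗮ ⊓ E :=
      ⟨S.sub_starProjection_mem_orthogonal η, E.sub_mem hη (hSE h1)⟩
    have h3 : ⟪S.starProjection η, ξ - S.starProjection ξ⟫_ℂ = 0 :=
      S.sub_starProjection_mem_orthogonal ξ _ h1
    have h4 : ⟪η - S.starProjection η, ξ - (Sᗮ ⊓ E).starProjection ξ⟫_ℂ = 0 :=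
      (Sᗮ ⊓ E).sub_starProjection_mem_orthogonal ξ _ h2
    have h5 : ⟪S.starProjection η, (Sᗮ ⊓ E).starProjection ξ⟫_ℂ = 0 :=
      ((Sᗮ ⊓ E).starProjection_apply_mem ξ).1 _ h1
    have h6 : ⟪η - S.starProjection η, S.starProjection ξ⟫_ℂ = 0 :=
      Submodule.inner_left_of_mem_orthogonal (S.starProjection_apply_mem ξ) h2.1
    have h7 : η = S.starProjection η + (η - S.starProjection η) := by abel
    rw [h7, inner_add_left]
    simp only [inner_sub_right, inner_add_right] at h3 h4 ⊢
    rw [h5, h6]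
    linear_combination h3 + h4

/-- A nonzero representation of `K(H)^G` does not vanish on the orthogonal projection to some
finite-dimensional invariant subspace without proper invariant subspaces. -/
theorem exists_minimal_invariantProj [Finite G] {K : Type z} [NormedAddCommGroup K]
    [InnerProductSpace ℂ K] [CompleteSpace K] (σ : equivariantCompacts π →⋆ₙₐ[ℂ] (K →L[ℂ] K))
    (hσ : ∃ T, σ T ≠ 0) : ∃ (E : Submodule ℂ H) (_ : FiniteDimensional ℂ E)
      (hE : ∀ g, ∀ ξ ∈ E, π g ξ ∈ E), σ (invariantProj E hE) ≠ 0 ∧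
        ∀ S ≤ E, (∀ g, ∀ ξ ∈ S, π g ξ ∈ S) → S = ⊥ ∨ S = E := by
  obtain ⟨T, hT⟩ := hσ
  have hex : ∃ n, ∃ (E : Submodule ℂ H) (_ : FiniteDimensional ℂ E)
      (hE : ∀ g, ∀ ξ ∈ E, π g ξ ∈ E), σ (invariantProj E hE) ≠ 0 ∧ Module.finrank ℂ E = n := by
    obtain ⟨E, hEf, hE, h⟩ := exists_norm_sub_invariantProj_mul_le T
      (half_pos (norm_pos_iff.2 hT))
    refine ⟨_, E, hEf, hE, fun h0 => ?_, rfl⟩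
    -- If `σ` killed the projection `P` to `E`, then `‖σ T‖ = ‖σ (T - P T)‖ ≤ ‖σ T‖ / 2`.
    have h1 := (NonUnitalStarAlgHom.norm_apply_le σ (T - invariantProj E hE * T)).trans h
    rw [map_sub, map_mul, h0, zero_mul, sub_zero] at h1
    linarith [norm_pos_iff.2 hT]
  classical
  obtain ⟨E, hEf, hE, hσE, hn⟩ := Nat.find_spec hex
  refine ⟨E, hEf, hE, hσE, fun S hSE hS => ?_⟩
  by_contra! hne
  have hSf : FiniteDimensional ℂ S := Submodule.finiteDimensional_of_le hSE
  have hSf' : FiniteDimensional ℂ (Sᗮ ⊓ E : Submodule ℂ H) :=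
    Submodule.finiteDimensional_of_le inf_le_right
  have hlt : ∀ (F : Submodule ℂ H) (_ : FiniteDimensional ℂ F) (hF : ∀ g, ∀ ξ ∈ F, π g ξ ∈ F),
      F < E → σ (invariantProj F hF) = 0 := by
    intro F _ hF hFE
    by_contra h0
    exact Nat.find_min hex (hn ▸ Submodule.finrank_lt_finrank_of_lt hFE) ⟨F, _, hF, h0, rfl⟩
  refine hσE ?_
  -- A proper nonzero invariant `S ≤ E` splits `E` into `S` and `Sᗮ ⊓ E`, both of smaller dimension,
  -- so `σ` kills both projections and hence their sum.
  rw [invariantProj_eq_add hSE hE hS, map_add, hlt S _ hS (lt_of_le_of_ne hSE hne.2),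
    hlt (Sᗮ ⊓ E) _ _ (lt_of_le_of_ne inf_le_right fun h => hne.1 ?_), add_zero]
  rw [inf_eq_right] at h
  exact (Submodule.eq_bot_iff S).2 fun ξ hξ =>
    inner_self_eq_zero.1 (h (hSE hξ) ξ hξ)

end InvariantProjections

/-! ### Classification of the irreducible representations of `K(H)^G`. -/

section Classification

variable {G : Type u} [Group G] [Finite G]
  {H : Type w} [NormedAddCommGroup H] [InnerProductSpace ℂ H] [CompleteSpace H]
  {π : G →* (H ≃ₗᵢ[ℂ] H)}
  {K : Type z} [NormedAddCommGroup K] [InnerProductSpace ℂ K] [CompleteSpace K]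

/-- A nonzero representation of `K(H)^G` does not vanish on `s s*` for some intertwiner `s` from
an irreducible representation. -/
theorem exists_irrep_compAdjoint (σ : equivariantCompacts π →⋆ₙₐ[ℂ] (K →L[ℂ] K))
    (hσ : ∃ T, σ T ≠ 0) : ∃ ρ : UnitaryIrrep.{u, r} G, Occurs ρ.hom π ∧
      ∃ s : HSInt ρ.hom π, σ (s.compAdjoint s) ≠ 0 := by
  obtain ⟨E, hEf, hE, hσE, hmin⟩ := exists_minimal_invariantProj σ hσ
  -- A copy of `E` in the universe `r`, where the irreducible representations are required to live.
  let V := EuclideanSpace ℂ (ULift.{r} (Fin (Module.finrank ℂ E)))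
  let e : V ≃ₗᵢ[ℂ] E := ((stdOrthonormalBasis ℂ E).reindex Equiv.ulift.symm).repr.symm
  let j : V →ₗᵢ[ℂ] H := E.subtypeₗᵢ.comp e.toLinearIsometry
  have hje : ∀ ζ, j ζ = e ζ := fun _ => rfl
  have hjE : ∀ ξ ∈ E, ∃ ζ, j ζ = ξ := fun ξ hξ => ⟨e.symm ⟨ξ, hξ⟩, by simp [hje]⟩
  have hj : ∀ g ζ, π g (j ζ) ∈ LinearMap.range j.toLinearMap := fun g ζ =>
    hjE _ (hE g _ (e ζ).2)
  have hirr : IsIrreducibleUnitary (restrictUnitary π j hj) := by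
    constructor
    · by_contra hV
      rw [not_nontrivial_iff_subsingleton] at hV
      refine hσE ?_
      convert map_zero σ
      apply Subtype.ext
      ext ξ
      change E.starProjection ξ = 0
      obtain ⟨ζ, hζ⟩ := hjE _ (E.starProjection_apply_mem ξ)
      rw [← hζ, Subsingleton.elim ζ 0, map_zero]
    · intro S _ hS
      rcases hmin (S.map j.toLinearMap) (by
        rintro _ ⟨ζ, _, rfl⟩
        exact (e ζ).2) (by
        rintro g _ ⟨ζ, hζ, rfl⟩
        exact ⟨_, hS g ζ hζ, apply_restrictUnitary π j hj g ζ⟩) with h | h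
      · left
        exact Submodule.map_injective_of_injective j.injective (h.trans (Submodule.map_bot _).symm)
      · right
        refine Submodule.eq_top_iff'.2 fun ζ => ?_
        obtain ⟨ζ', hζ', h'⟩ : j ζ ∈ S.map j.toLinearMap := by
          rw [h]
          exact (e ζ).2
        exact j.injective h' ▸ hζ'
  let ρ : UnitaryIrrep.{u, r} G := ⟨V, restrictUnitary π j hj, hirr⟩
  refine ⟨ρ, ⟨j, apply_restrictUnitary π j hj⟩,
    HSInt.mk j.toContinuousLinearMap (apply_restrictUnitary π j hj), ?_⟩
  -- The isometry `j` has range `E`, so `j j*` is the projection to `E`.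
  convert hσE
  apply Subtype.ext
  ext ξ
  change j (ContinuousLinearMap.adjoint j.toContinuousLinearMap ξ) = E.starProjection ξ
  symm
  apply Submodule.eq_starProjection_of_mem_of_inner_eq_zero (e _).2
  intro η hη
  obtain ⟨ζ, rfl⟩ := hjE η hη
  rw [inner_sub_left, ← hje, j.inner_map_map, ContinuousLinearMap.adjoint_inner_left]
  exact sub_self _

/-- Every irreducible representation of `K(H)^G` is equivalent to the representation on
`HS(ρ, π)^G` for some irreducible representation `ρ` of `G` that occurs in `π`. -/
theorem exists_repEquiv_hsRep (σ : equivariantCompacts π →⋆ₙₐ[ℂ] (K →L[ℂ] K))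
    (hσ : IsIrreducibleRep σ) : ∃ ρ : UnitaryIrrep.{u, r} G, Occurs ρ.hom π ∧
      RepEquiv σ (hsRep π ρ.hom) := by
  obtain ⟨ρ, hρ, s, hs⟩ := exists_irrep_compAdjoint.{u, w, r, z} σ hσ.1
  refine ⟨ρ, hρ, ?_⟩
  have hirr := ρ.irreducible
  set n : ℂ := (Module.finrank ℂ ρ.carrier : ℂ) with hn
  have hn0 : n ≠ 0 := hirr.finrank_ne_zero
  obtain ⟨η, hη⟩ : ∃ η, σ (s.compAdjoint s) η ≠ 0 := by
    by_contra! h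
    exact hs (ContinuousLinearMap.ext h)
  have hs0 : s ≠ 0 := by
    rintro rfl
    exact hs (map_zero σ)
  -- Since `s s*` is a multiple of a projection, any vector in the range of `σ (s s*)` is an
  -- eigenvector.
  set ξ := σ (s.compAdjoint s) η with hξ
  have hξs : σ (s.compAdjoint s) ξ = (⟪s, s⟫_ℂ / n) • ξ := by
    rw [hξ, ← mul_apply_eq_comp, ← map_mul, HSInt.compAdjoint_mul hirr, map_smul,
      smul_apply]
  let U₀ : HSInt ρ.hom π →ₗ[ℂ] K :=
    { toFun := fun t => σ (t.compAdjoint s) ξ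
      map_add' := fun t t' => by rw [HSInt.compAdjoint_add, map_add, add_apply]
      map_smul' := fun c t => by
        rw [HSInt.compAdjoint_smul, map_smul, smul_apply, RingHom.id_apply] }
  have hU₀ : ∀ t, U₀ t = σ (t.compAdjoint s) ξ := fun _ => rfl
  -- The left side is `⟪ξ, σ(s t* t' s*) ξ⟫`. One factor `1 / n` comes from the scalar `t* t'`, the
  -- other from the eigenvalue of `σ (s s*)` at `ξ`.
  have hinner : ∀ t t', ⟪U₀ t, U₀ t'⟫_ℂ = ⟪t, t'⟫_ℂ * ((⟪s, s⟫_ℂ / n ^ 2) * ⟪ξ, ξ⟫_ℂ) := by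
    intro t t'
    rw [hU₀, hU₀, ← ContinuousLinearMap.adjoint_inner_right, ← ContinuousLinearMap.star_eq_adjoint,
      ← map_star, ← mul_apply_eq_comp, ← map_mul, HSInt.star_compAdjoint,
      HSInt.compAdjoint_mul hirr, map_smul, smul_apply, hξs, inner_smul_right, inner_smul_right, ← hn]
    field_simp
  set c : ℝ := ‖s‖ / Module.finrank ℂ ρ.carrier * ‖ξ‖ with hc
  have hc0 : 0 < c := by
    have := hirr.1
    have : 0 < Module.finrank ℂ ρ.carrier := Module.finrank_pos
    have := norm_pos_iff.2 hs0
    have := norm_pos_iff.2 hη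
    positivity
  have hnorm : ∀ t, ‖U₀ t‖ = c * ‖t‖ := by
    intro t
    rw [← sq_eq_sq₀ (norm_nonneg _) (by positivity)]
    have h := hinner t t
    simp only [inner_self_eq_norm_sq_to_K] at h
    have h' : ((‖U₀ t‖ ^ 2 : ℝ) : ℂ) = ((c * ‖t‖) ^ 2 : ℝ) := by
      push_cast
      rw [hc]
      push_cast
      refine h.trans ?_
      rw [hn]
      simp only [RCLike.ofReal_eq_complex_ofReal]
      field_simp
    exact_mod_cast h'
  let U : HSInt ρ.hom π →ₗᵢ[ℂ] K :=
    { toLinearMap := ((c⁻¹ : ℝ) : ℂ) • U₀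
      norm_map' := fun t => by
        rw [LinearMap.smul_apply, norm_smul, hnorm, Complex.norm_real, Real.norm_of_nonneg
          (by positivity), inv_mul_cancel_left₀ hc0.ne'] }
  have hU : ∀ t, U t = ((c⁻¹ : ℝ) : ℂ) • σ (t.compAdjoint s) ξ := fun _ => rfl
  have hUσ : ∀ T t, U (hsRep π ρ.hom T t) = σ T (U t) := by
    intro T t
    rw [hU, hU, HSInt.compAdjoint_hsRep, map_mul, map_smul]
    rfl
  -- The range of an isometry on a complete space is closed; being invariant and nonzero, it is
  -- everything by irreducibility of `σ`.
  have hrange : LinearMap.range U.toLinearMap = ⊤ := by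
    refine (hσ.2 _ ?_ ?_).resolve_left fun h0 => hs0 ?_
    · exact U.isometry.isClosedEmbedding.isClosed_range
    · rintro T _ ⟨t, rfl⟩
      exact ⟨_, hUσ T t⟩
    · have h1 : U s ∈ LinearMap.range U.toLinearMap := ⟨s, rfl⟩
      rw [h0, Submodule.mem_bot] at h1
      rwa [← map_zero U, U.injective.eq_iff] at h1
  let e : HSInt ρ.hom π ≃ₗᵢ[ℂ] K :=
    LinearIsometryEquiv.ofSurjective U (LinearMap.range_eq_top.1 hrange)
  exact ⟨e.symm, fun T ζ => by
    rw [LinearIsometryEquiv.symm_apply_eq]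
    have := hUσ T (e.symm ζ)
    change e _ = σ T (e (e.symm ζ)) at this
    rw [this, e.apply_symm_apply]⟩

end Classification

/-! ### From strong to norm continuity. -/

section NormContinuity

variable {Y : Type v} [TopologicalSpace Y]
  {H : Type w} [NormedAddCommGroup H] [InnerProductSpace ℂ H]

/-- Composing a norm continuous family of compact operators with a strongly continuous family of
isometries gives a norm continuous family. -/
theorem continuous_comp_of_isCompactOperator {φ : Y → (H ≃ₗᵢ[ℂ] H)}
    (hφ : Continuous fun p : Y × H => φ p.1 p.2) {T : Y → H →L[ℂ] H} (hT : Continuous T)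
    (hTc : ∀ y, IsCompactOperator (T y)) :
    Continuous fun y => (φ y : H →L[ℂ] H) ∘L T y := by
  refine continuous_iff_continuousAt.2 fun y₀ => Metric.tendsto_nhds.2 fun ε hε => ?_
  -- Joint continuity of `φ` gives uniform convergence on compact sets only; compactness of `T y₀`
  -- confines the image of the unit ball to such a set.
  obtain ⟨C, hC, hCT⟩ := IsCompactOperator.image_closedBall_subset_compact
    (f := ((T y₀ : H →L[ℂ] H) : H →ₗ[ℂ] H)) (hTc y₀) 1
  have h1 : ∀ᶠ y in nhds y₀, ∀ ξ ∈ C, ‖φ y ξ - φ y₀ ξ‖ < ε / 3 := by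
    refine hC.eventually_forall_of_forall_eventually fun ξ _ => ?_
    have hc : Continuous fun p : Y × H => ‖φ p.1 p.2 - φ y₀ p.2‖ :=
      (hφ.sub ((φ y₀).continuous.comp continuous_snd)).norm
    exact hc.continuousAt.eventually_lt continuousAt_const (by simpa using by positivity)
  have h2 : ∀ᶠ y in nhds y₀, ‖T y - T y₀‖ < ε / 3 := by
    have := Metric.tendsto_nhds.1 (hT.continuousAt (x := y₀)) (ε / 3) (by positivity)
    simpa only [dist_eq_norm] using this
  filter_upwards [h1, h2] with y hy1 hy2
  rw [dist_eq_norm]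
  refine lt_of_le_of_lt (ContinuousLinearMap.opNorm_le_of_unit_norm
    (C := ε / 3 + ε / 3) (by positivity) fun ξ hξ => ?_) (by linarith)
  have h3 : (((φ y : H →L[ℂ] H) ∘L T y) - ((φ y₀ : H →L[ℂ] H) ∘L T y₀)) ξ =
      φ y ((T y - T y₀) ξ) + (φ y (T y₀ ξ) - φ y₀ (T y₀ ξ)) := by
    simp
  rw [h3]
  refine (norm_add_le _ _).trans (add_le_add ?_ ?_)
  · rw [LinearIsometryEquiv.norm_map]
    exact ((T y - T y₀).le_opNorm_of_le hξ.le).trans (by linarith)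
  · exact (hy1 _ (hCT ⟨ξ, by simp [hξ], rfl⟩)).le

end NormContinuity

/-! ### Extending operators at one point to invariant fields. -/

section FixedAlgebra

variable {W : Type u} [Group W] {X : Type v} [TopologicalSpace X] [MulAction W X]
  {H : Type w} [NormedAddCommGroup H] [InnerProductSpace ℂ H]

theorem BundleAction.continuous_I (I : BundleAction W X H) (g : W) :
    Continuous fun p : X × H => I.I g p.1 p.2 := by
  have h : (fun p : X × H => I.I g p.1 p.2) = fun p => (I.act g p).2 := by
    ext p
    rw [I.act_apply]
  rw [h]
  exact continuous_snd.comp (I.act g).continuous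

theorem BundleAction.I_mul_apply (I : BundleAction W X H) (g g' : W) (x : X) (ξ : H) :
    I.I (g * g') x ξ = I.I g (g' • x) (I.I g' x ξ) := by
  rw [I.I_mul]
  rfl

/-- The translate `x ↦ I_{g, g⁻¹x} T I_{g⁻¹, x}` of a constant operator field. -/
def BundleAction.translate (I : BundleAction W X H) (T : H →L[ℂ] H) (g : W) (x : X) :
    H →L[ℂ] H :=
  (I.I g (g⁻¹ • x) : H →L[ℂ] H) ∘L T ∘L (I.I g⁻¹ x : H →L[ℂ] H)

theorem BundleAction.translate_apply (I : BundleAction W X H) (T : H →L[ℂ] H) (g : W) (x : X)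
    (ξ : H) : I.translate T g x ξ = I.I g (g⁻¹ • x) (T (I.I g⁻¹ x ξ)) := rfl

theorem BundleAction.isCompactOperator_translate (I : BundleAction W X H) {T : H →L[ℂ] H}
    (hT : IsCompactOperator T) (g : W) (x : X) : IsCompactOperator (I.translate T g x) :=
  (hT.comp_clm (I.I g⁻¹ x : H →L[ℂ] H)).clm_comp (I.I g (g⁻¹ • x) : H →L[ℂ] H)

theorem BundleAction.translate_mul_apply (I : BundleAction W X H) (T : H →L[ℂ] H) (g g' : W)
    (x : X) (ξ : H) : I.translate T (g * g') x ξ =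
      I.I g (g⁻¹ • x) (I.translate T g' (g⁻¹ • x) (I.I g⁻¹ x ξ)) := by
  rw [I.translate_apply, I.translate_apply, mul_inv_rev, mul_smul, I.I_mul_apply g g',
    I.I_mul_apply g'⁻¹ g⁻¹, smul_inv_smul]

variable [CompleteSpace H]

theorem BundleAction.translate_eq_self (I : BundleAction W X H) {x : X} {T : H →L[ℂ] H}
    (hT : T ∈ equivariantCompacts (I.isotropyRep x)) {g : W} (hg : g⁻¹ • x = x) :
    I.translate T g x = T := by
  have hg' : g ∈ MulAction.stabilizer W x := (inv_smul_eq_iff.1 hg).symm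
  ext ξ
  rw [I.translate_apply, hg]
  have h := hT.2 ⟨g, hg'⟩ (I.I g⁻¹ x ξ)
  change T (I.I g x _) = I.I g x _ at h
  rw [← h]
  congr 1
  have h2 := I.I_mul_apply g g⁻¹ x ξ
  rw [hg, mul_inv_cancel, I.I_one] at h2
  exact h2.symm

theorem KOp.isometry_toCLM : Isometry (KOp.toCLM : KOp H → (H →L[ℂ] H)) :=
  AddMonoidHomClass.isometry_of_norm _ KOp.norm_toCLM

theorem KOp.continuous_iff {Y : Type*} [TopologicalSpace Y] {f : Y → KOp H} :
    Continuous f ↔ Continuous fun y => (f y).toCLM :=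
  KOp.isometry_toCLM.isEmbedding.continuous_iff

theorem BundleAction.continuous_translate [ContinuousConstSMul W X] (I : BundleAction W X H)
    {T : H →L[ℂ] H} (hT : IsCompactOperator T) (g : W) : Continuous (I.translate T g) := by
  have hI : Continuous fun p : X × H => I.I g (g⁻¹ • p.1) p.2 :=
    (I.continuous_I g).comp (g := fun p : X × H => I.I g p.1 p.2)
      (f := fun p : X × H => (g⁻¹ • p.1, p.2)) (by fun_prop)
  have h1 : Continuous fun x => T ∘L (I.I g⁻¹ x : H →L[ℂ] H) := by
    -- Right multiplication by a strongly continuous unitary family becomes left multiplication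
    -- after taking adjoints, and the adjoint is norm continuous.
    have h : (fun x => T ∘L (I.I g⁻¹ x : H →L[ℂ] H)) = fun x =>
        ContinuousLinearMap.adjoint ((I.I g (g⁻¹ • x) : H →L[ℂ] H) ∘L
          ContinuousLinearMap.adjoint T) := by
      ext x ξ
      refine ext_inner_left ℂ fun η => ?_
      rw [ContinuousLinearMap.adjoint_inner_right, ContinuousLinearMap.comp_apply,
        ContinuousLinearMap.comp_apply, ← ContinuousLinearMap.adjoint_inner_left]
      have h2 := I.I_mul_apply g g⁻¹ x ξ
      rw [mul_inv_cancel, I.I_one] at h2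
      conv_rhs => rw [show ξ = I.I g (g⁻¹ • x) (I.I g⁻¹ x ξ) from h2]
      exact ((I.I g (g⁻¹ • x)).inner_map_map _ _).symm
    rw [h]
    refine ContinuousLinearMap.adjoint.continuous.comp (continuous_comp_of_isCompactOperator
      hI
      continuous_const fun _ => isCompactOperator_adjoint hT)
  exact continuous_comp_of_isCompactOperator
    hI
    h1 fun _ => hT.comp_clm _

/-- Every compact operator commuting with the isotropy representation at `x` is the value at `x`
of an element of the fixed-point algebra, which may be chosen to vanish at finitely many points
outside the orbit of `x`. -/
theorem BundleAction.exists_fixedAlgebra_apply_eq [Finite W] [LocallyCompactSpace X] [T2Space X]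
    [ContinuousConstSMul W X] (I : BundleAction W X H) {x : X} {T : H →L[ℂ] H}
    (hT : T ∈ equivariantCompacts (I.isotropyRep x)) {F : Set X} (hF : F.Finite)
    (hxF : ∀ y ∈ F, y ∉ MulAction.orbit W x) :
    ∃ k : I.fixedAlgebra, ((k : C₀(X, KOp H)) x).toCLM = T ∧
      ∀ y ∈ F, (k : C₀(X, KOp H)) y = 0 := by
  have := Fintype.ofFinite W
  have := hF.to_subtype
  -- The bump function at `x` must vanish at the other points of the orbit of `x`, so that averaging
  -- does not alter the value there, and on the orbits of the points of `F`.
  let t : Set X := (Set.range (fun g : W => g • x) \ {x}) ∪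
    Set.range fun p : W × F => p.1 • (p.2 : X)
  have ht : t.Finite := (Set.finite_range _).sdiff.union (Set.finite_range _)
  have hxt : x ∉ t := by
    rintro (h | ⟨⟨g, y, hy⟩, h⟩)
    · exact h.2 rfl
    · refine hxF y hy ⟨g⁻¹, ?_⟩
      rw [← h]
      exact inv_smul_smul g y
  obtain ⟨f, hfx, hft, hfc, hf01⟩ := exists_continuous_one_zero_of_isCompact
    (isCompact_singleton (x := x)) ht.isClosed (Set.disjoint_singleton_left.2 hxt)
  -- This normalizing constant is the order of the isotropy group: the terms are 1 on it and 0
  -- elsewhere.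
  let m : ℝ := ∑ g : W, f (g⁻¹ • x)
  have hm : m ≠ 0 := by
    have h1 : f ((1 : W)⁻¹ • x) ≤ m :=
      Finset.single_le_sum (f := fun g : W => f (g⁻¹ • x)) (fun g _ => (hf01 _).1)
        (Finset.mem_univ 1)
    have h2 : f x = 1 := hfx rfl
    rw [inv_one, one_smul, h2] at h1
    linarith
  let k₀ : X → H →L[ℂ] H := fun y => ((m⁻¹ : ℝ) : ℂ) • ∑ g : W,
    ((f (g⁻¹ • y) : ℝ) : ℂ) • I.translate T g y
  have hk₀c : Continuous k₀ := by
    have h (g : W) : Continuous fun y => ((f (g⁻¹ • y) : ℝ) : ℂ) • I.translate T g y :=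
      have hf : Continuous fun y => ((f (g⁻¹ • y) : ℝ) : ℂ) := by fun_prop
      hf.smul (I.continuous_translate hT.1 g)
    have h' : Continuous fun y => ∑ g : W, ((f (g⁻¹ • y) : ℝ) : ℂ) • I.translate T g y :=
      continuous_finsetSum _ fun g _ => h g
    exact h'.const_smul ((m⁻¹ : ℝ) : ℂ)
  have hk₀K : ∀ y, IsCompactOperator (k₀ y) := fun y =>
    SMulMemClass.smul_mem (s := compactOps H) _ (sum_mem fun g _ =>
      SMulMemClass.smul_mem (s := compactOps H) _ (I.isCompactOperator_translate hT.1 g y))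
  let k : C₀(X, KOp H) :=
    { toFun := fun y => KOp.mk (k₀ y) (hk₀K y)
      continuous_toFun := KOp.continuous_iff.2 hk₀c
      zero_at_infty' := by
        refine tendsto_const_nhds.congr' ?_
        have hC : IsCompact (⋃ g : W, (fun y => g • y) '' tsupport f) :=
          isCompact_iUnion fun g => hfc.isCompact.image (continuous_const_smul g)
        filter_upwards [hC.compl_mem_cocompact] with y hy
        apply KOp.toCLM_injective
        rw [map_zero]
        symm
        change k₀ y = 0
        refine smul_eq_zero_of_right _ (Finset.sum_eq_zero fun g _ => ?_)
        have : f (g⁻¹ • y) = 0 := by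
          by_contra h
          exact hy (Set.mem_iUnion.2 ⟨g, g⁻¹ • y, subset_tsupport f h, smul_inv_smul g y⟩)
        rw [this, Complex.ofReal_zero, zero_smul] }
  have hkk : ∀ y, (k y).toCLM = k₀ y := fun _ => rfl
  refine ⟨⟨k, fun g y => ?_⟩, ?_, fun y hy => KOp.toCLM_injective ?_⟩
  · ext ξ
    have h1 : I.alpha g k y ξ = I.I g (g⁻¹ • y) (k₀ (g⁻¹ • y) (I.I g⁻¹ y ξ)) := rfl
    rw [h1, hkk]
    simp only [k₀, smul_apply, sum_apply, map_smul, map_sum]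
    congr 1
    -- Invariance of an average: applying `α_g` permutes the summands by left translation.
    refine Fintype.sum_equiv (Equiv.mulLeft g) _ _ fun g' => ?_
    rw [Equiv.coe_mulLeft, I.translate_mul_apply, mul_inv_rev, mul_smul]
  · change k₀ x = T
    have h1 : ∀ g : W, ((f (g⁻¹ • x) : ℝ) : ℂ) • I.translate T g x =
        ((f (g⁻¹ • x) : ℝ) : ℂ) • T := by
      intro g
      by_cases hg : g⁻¹ • x = x
      · rw [I.translate_eq_self hT hg]
      · have : f (g⁻¹ • x) = 0 := hft (Or.inl ⟨⟨g⁻¹, rfl⟩, hg⟩)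
        rw [this, Complex.ofReal_zero, zero_smul, zero_smul]
    simp only [k₀, h1]
    rw [← Finset.sum_smul, smul_smul, ← Complex.ofReal_sum, ← Complex.ofReal_mul,
      inv_mul_cancel₀ hm, Complex.ofReal_one, one_smul]
  · change k₀ y = _
    rw [map_zero]
    refine smul_eq_zero_of_right _ (Finset.sum_eq_zero fun g _ => ?_)
    have : f (g⁻¹ • y) = 0 := hft (Or.inr ⟨(g⁻¹, ⟨y, hy⟩), rfl⟩)
    rw [this, Complex.ofReal_zero, zero_smul]

/-- Evaluation at a point, from the fixed-point algebra to `K(H)^{W_x}`. -/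
def BundleAction.evalAt (I : BundleAction W X H) (x : X) :
    I.fixedAlgebra →⋆ₙₐ[ℂ] equivariantCompacts (I.isotropyRep x) where
  toFun k := ⟨((k : C₀(X, KOp H)) x).toCLM, KOp.isCompactOperator _, I.fixedAlgebra_commute k x⟩
  map_smul' _ _ := rfl
  map_zero' := rfl
  map_add' _ _ := rfl
  map_mul' _ _ := rfl
  map_star' _ := rfl

theorem BundleAction.evalAt_eq_zero_iff (I : BundleAction W X H) {x : X} {k : I.fixedAlgebra} :
    I.evalAt x k = 0 ↔ (k : C₀(X, KOp H)) x = 0 := by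
  rw [← KOp.toCLM_injective.eq_iff, Subtype.ext_iff, map_zero]
  rfl

theorem BundleAction.evalAt_surjective [Finite W] [LocallyCompactSpace X] [T2Space X]
    [ContinuousConstSMul W X] (I : BundleAction W X H) (x : X) :
    Function.Surjective (I.evalAt x) := by
  intro T
  obtain ⟨k, hk, -⟩ := I.exists_fixedAlgebra_apply_eq T.2 Set.finite_empty (by simp)
  exact ⟨k, Subtype.ext hk⟩

/-- With surjectivity of `evalAt`, this factorization transfers questions about `π_{x, ρ}` to
`K(H)^{W_x}`. -/
theorem BundleAction.rep_eq [Finite W] (I : BundleAction W X H) (x : X)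
    (ρ : UnitaryIrrep.{u, r} (MulAction.stabilizer W x)) (k : I.fixedAlgebra) :
    I.rep x ρ k = hsRep (I.isotropyRep x) ρ.hom (I.evalAt x k) := rfl

/-- The representations `π_{x, ρ}` are irreducible. -/
theorem BundleAction.isIrreducibleRep_rep [Finite W] [LocallyCompactSpace X] [T2Space X]
    [ContinuousConstSMul W X] (I : BundleAction W X H) (x : X)
    (ρ : UnitaryIrrep.{u, r} (MulAction.stabilizer W x))
    (hρ : Occurs ρ.hom (I.isotropyRep x)) : IsIrreducibleRep (I.rep x ρ) := by
  obtain ⟨⟨T, hT⟩, h⟩ := isIrreducibleRep_hsRep ρ.irreducible hρ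
  obtain ⟨k, rfl⟩ := I.evalAt_surjective x T
  refine ⟨⟨k, hT⟩, fun S hS hinv => h S hS fun T => ?_⟩
  obtain ⟨k, rfl⟩ := I.evalAt_surjective x T
  exact hinv k

end FixedAlgebra

/-! ### Irreducible representations live at a single point. -/

/-- The kernel of an irreducible representation is a prime ideal. -/
theorem IsIrreducibleRep.exists_mul_mul_ne_zero
    {A : Type u} [NonUnitalRing A] [StarRing A] [Module ℂ A]
    {K : Type v} [NormedAddCommGroup K] [InnerProductSpace ℂ K] [CompleteSpace K]
    {π : A →⋆ₙₐ[ℂ] (K →L[ℂ] K)} (hπ : IsIrreducibleRep π) {a b : A} (ha : π a ≠ 0)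
    (hb : π b ≠ 0) : ∃ c, π (a * c * b) ≠ 0 := by
  by_contra! h
  -- `N` is closed and invariant, and contains the range of `π b` under the contrary assumption. So
  -- `N = ⊥` forces `π b = 0`, while `N = ⊤` forces `π (a a*) = 0`, hence `π a = 0`.
  let N : Submodule ℂ K := ⨅ c, LinearMap.ker (π (a * c) : K →ₗ[ℂ] K)
  have hN : ∀ ξ, ξ ∈ N ↔ ∀ c, π (a * c) ξ = 0 := fun ξ => by
    simp only [N, Submodule.mem_iInf, LinearMap.mem_ker, ContinuousLinearMap.coe_coe]
  have hNc : IsClosed (N : Set K) := by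
    have : (N : Set K) = ⋂ c, {ξ | π (a * c) ξ = 0} := by
      ext ξ
      simp [hN]
    rw [this]
    exact isClosed_iInter fun c => isClosed_eq (π (a * c)).continuous continuous_const
  rcases hπ.2 N hNc (fun c ξ hξ => by
    rw [hN] at hξ ⊢
    intro d
    rw [← mul_apply_eq_comp, ← map_mul, mul_assoc]
    exact hξ _) with h0 | h1
  · refine hb (ContinuousLinearMap.ext fun ξ => ?_)
    have : π b ξ ∈ N := (hN _).2 fun c => by
      rw [← mul_apply_eq_comp, ← map_mul, h, zero_apply]
    rwa [h0, Submodule.mem_bot] at this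
  · have h2 : π (a * star a) = 0 := ContinuousLinearMap.ext fun ξ =>
      (hN ξ).1 (h1 ▸ Submodule.mem_top) (star a)
    rw [map_mul, map_star] at h2
    exact ha ((CStarRing.mul_star_self_eq_zero_iff _).1 h2)

section Localization

variable {W : Type u} [Group W] {X : Type v} [TopologicalSpace X] [MulAction W X]
  {H : Type w} [NormedAddCommGroup H] [InnerProductSpace ℂ H] [CompleteSpace H]

theorem ZeroAtInfty.continuous_eval {E : Type*} [NormedAddCommGroup E] (x : X) :
    Continuous fun k : C₀(X, E) => k x :=
  (LipschitzWith.mk_one fun k l =>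
    BoundedContinuousFunction.dist_coe_le_dist (f := k.toBCF) (g := l.toBCF) x).continuous

theorem ZeroAtInfty.norm_le {E : Type*} [NormedAddCommGroup E] {k : C₀(X, E)} {C : ℝ}
    (hC : 0 ≤ C) (h : ∀ x, ‖k x‖ ≤ C) : ‖k‖ ≤ C := by
  rw [← ZeroAtInftyContinuousMap.norm_toBCF_eq_norm]
  exact (BoundedContinuousFunction.norm_le hC).2 h

theorem BundleAction.mem_fixedAlgebra_iff (I : BundleAction W X H) {k : C₀(X, KOp H)} :
    k ∈ I.fixedAlgebra ↔ ∀ g x, I.alpha g k x = (k x).toCLM := Iff.rfl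

theorem BundleAction.isClosed_fixedAlgebra (I : BundleAction W X H) :
    IsClosed (I.fixedAlgebra : Set C₀(X, KOp H)) := by
  have h : (I.fixedAlgebra : Set C₀(X, KOp H)) =
      ⋂ g, ⋂ x, {k | I.alpha g k x = (k x).toCLM} := by
    ext k
    simp [I.mem_fixedAlgebra_iff]
  have hc : ∀ x, Continuous fun k : C₀(X, KOp H) => (k x).toCLM := fun x =>
    KOp.isometry_toCLM.continuous.comp (ZeroAtInfty.continuous_eval x)
  rw [h]
  refine isClosed_iInter fun g => isClosed_iInter fun x => isClosed_eq ?_ (hc x)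
  exact continuous_const.clm_comp ((hc _).clm_comp continuous_const)

instance (I : BundleAction W X H) : NonUnitalCStarAlgebra I.fixedAlgebra :=
  haveI : IsClosed (I.fixedAlgebra : Set C₀(X, KOp H)) := I.isClosed_fixedAlgebra
  inferInstance

/-- Invariance of the pointwise norm lets scalar functions of `‖k x‖` multiply `k` without leaving
the fixed-point algebra. -/
theorem BundleAction.norm_fixedAlgebra_smul (I : BundleAction W X H) (k : I.fixedAlgebra) (g : W)
    (x : X) : ‖(k : C₀(X, KOp H)) (g • x)‖ = ‖(k : C₀(X, KOp H)) x‖ := by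
  have key : ∀ (g : W) (x : X), ‖(k : C₀(X, KOp H)) x‖ ≤ ‖(k : C₀(X, KOp H)) (g⁻¹ • x)‖ := by
    intro g x
    rw [← KOp.norm_toCLM, ← k.2 g x]
    refine ContinuousLinearMap.opNorm_le_bound _ (norm_nonneg _) fun ξ => ?_
    rw [I.alpha_apply, LinearIsometryEquiv.norm_map]
    refine (ContinuousLinearMap.le_opNorm _ _).trans_eq ?_
    rw [LinearIsometryEquiv.norm_map, KOp.norm_toCLM]
  refine le_antisymm ?_ ?_
  · simpa using key g (g • x)
  · simpa using key g⁻¹ x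

/-- The field `x ↦ f ‖k x‖ • k x`, for `k` in the fixed-point algebra. -/
def BundleAction.cutoff (I : BundleAction W X H) (f : C(ℝ, ℝ)) (hf : ∀ t, f t ∈ Set.Icc (0 : ℝ) 1)
    (k : I.fixedAlgebra) : I.fixedAlgebra :=
  ⟨{ toFun := fun x => ((f ‖(k : C₀(X, KOp H)) x‖ : ℝ) : ℂ) • (k : C₀(X, KOp H)) x
     continuous_toFun := by
       have hk := map_continuous (k : C₀(X, KOp H))
       have hfk : Continuous fun x => ((f ‖(k : C₀(X, KOp H)) x‖ : ℝ) : ℂ) := by fun_prop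
       exact hfk.smul hk
     zero_at_infty' := by
       refine squeeze_zero_norm (fun x => ?_)
         (tendsto_zero_iff_norm_tendsto_zero.1 (k : C₀(X, KOp H)).zero_at_infty')
       rw [norm_smul, Complex.norm_real, Real.norm_of_nonneg (hf _).1]
       exact mul_le_of_le_one_left (norm_nonneg _) (hf _).2 }, fun g x => by
    have h := k.2 g x
    ext ξ
    have h1 := congr($h ξ)
    have h2 := I.norm_fixedAlgebra_smul k g⁻¹ x
    rw [I.alpha_apply] at h1 ⊢
    change I.I g (g⁻¹ • x) (((f ‖(k : C₀(X, KOp H)) (g⁻¹ • x)‖ : ℝ) : ℂ) •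
      ((k : C₀(X, KOp H)) (g⁻¹ • x)).toCLM _) = ((f ‖(k : C₀(X, KOp H)) x‖ : ℝ) : ℂ) •
        ((k : C₀(X, KOp H)) x).toCLM ξ
    rw [map_smul, h1, h2]⟩

theorem BundleAction.cutoff_apply (I : BundleAction W X H) (f : C(ℝ, ℝ))
    (hf : ∀ t, f t ∈ Set.Icc (0 : ℝ) 1) (k : I.fixedAlgebra) (x : X) :
    (I.cutoff f hf k : C₀(X, KOp H)) x =
      ((f ‖(k : C₀(X, KOp H)) x‖ : ℝ) : ℂ) • (k : C₀(X, KOp H)) x := rfl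

/-- If a representation does not vanish on `k`, it does not vanish on some `k'` which is zero
wherever `k` is small. -/
theorem BundleAction.exists_cutoff (I : BundleAction W X H) {K : Type z} [NormedAddCommGroup K]
    [InnerProductSpace ℂ K] [CompleteSpace K] (π : I.fixedAlgebra →⋆ₙₐ[ℂ] (K →L[ℂ] K))
    {k : I.fixedAlgebra} (hk : π k ≠ 0) : ∃ ε > 0, ∃ k' : I.fixedAlgebra, π k' ≠ 0 ∧
      ∀ x, ‖(k : C₀(X, KOp H)) x‖ < ε → (k' : C₀(X, KOp H)) x = 0 := by
  set ε : ℝ := ‖π k‖ / 4 with hε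
  have hε0 : 0 < ε := by
    have := norm_pos_iff.2 hk
    positivity
  -- `f` is 0 up to `ε` and 1 from `2 * ε` on, so the cutoff changes `k` by at most `2 * ε = ‖π k‖ /
  -- 2`, too little for `π` to vanish on it.
  let f : C(ℝ, ℝ) := ⟨fun t => max 0 (min 1 (t / ε - 1)), by fun_prop⟩
  have hfe : ∀ t, f t = max 0 (min 1 (t / ε - 1)) := fun _ => rfl
  have hf : ∀ t, f t ∈ Set.Icc (0 : ℝ) 1 := fun t =>
    ⟨le_max_left _ _, max_le zero_le_one (min_le_left _ _)⟩
  refine ⟨ε, hε0, I.cutoff f hf k, fun h0 => ?_, fun x hx => ?_⟩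
  · have h1 : ‖k - I.cutoff f hf k‖ ≤ 2 * ε := by
      refine ZeroAtInfty.norm_le (k := ((k - I.cutoff f hf k : I.fixedAlgebra) : C₀(X, KOp H)))
        (by positivity) fun x => ?_
      change ‖(k : C₀(X, KOp H)) x - ((f ‖(k : C₀(X, KOp H)) x‖ : ℝ) : ℂ) •
        (k : C₀(X, KOp H)) x‖ ≤ 2 * ε
      set a := (k : C₀(X, KOp H)) x
      have h2 : a - ((f ‖a‖ : ℝ) : ℂ) • a = ((1 - f ‖a‖ : ℝ) : ℂ) • a := by
        rw [Complex.ofReal_sub, sub_smul, Complex.ofReal_one, one_smul]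
      rw [h2, norm_smul, Complex.norm_real, Real.norm_of_nonneg (sub_nonneg.2 (hf _).2)]
      by_cases ha : ‖a‖ ≤ 2 * ε
      · exact (mul_le_of_le_one_left (norm_nonneg _) (sub_le_self _ (hf _).1)).trans ha
      · have h3 : 2 ≤ ‖a‖ / ε := by
          rw [le_div_iff₀ hε0]
          linarith
        have h4 : f ‖a‖ = 1 := by
          rw [hfe, min_eq_left (by linarith), max_eq_right zero_le_one]
        rw [h4, sub_self, zero_mul]
        positivity
    have h2 := (NonUnitalStarAlgHom.norm_apply_le π (k - I.cutoff f hf k)).trans h1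
    rw [map_sub, h0, sub_zero] at h2
    linarith
  · have h3 : ‖(k : C₀(X, KOp H)) x‖ / ε < 1 := by
      rw [div_lt_one hε0]
      exact hx
    rw [I.cutoff_apply, hfe, max_eq_left ((min_le_right _ _).trans (by linarith)),
      Complex.ofReal_zero, zero_smul]

/-- An irreducible representation of the fixed-point algebra factors through the evaluation at
some point. -/
theorem BundleAction.exists_forall_eq_zero (I : BundleAction W X H) {K : Type z}
    [NormedAddCommGroup K] [InnerProductSpace ℂ K] [CompleteSpace K]
    {π : I.fixedAlgebra →⋆ₙₐ[ℂ] (K →L[ℂ] K)} (hπ : IsIrreducibleRep π) :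
    ∃ x : X, ∀ k : I.fixedAlgebra, (k : C₀(X, KOp H)) x = 0 → π k = 0 := by
  by_contra! h
  have hloc : ∀ x : X, ∃ k : I.fixedAlgebra, π k ≠ 0 ∧
      ∀ᶠ y in nhds x, (k : C₀(X, KOp H)) y = 0 := by
    intro x
    obtain ⟨k, hkx, hk⟩ := h x
    obtain ⟨ε, hε, k', hk', hz⟩ := I.exists_cutoff π hk
    refine ⟨k', hk', ?_⟩
    have hc : Continuous fun y => ‖(k : C₀(X, KOp H)) y‖ := (k : C₀(X, KOp H)).continuous.norm
    filter_upwards [hc.continuousAt.eventually_lt continuousAt_const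
      (by rwa [hkx, norm_zero])] with y hy using hz y hy
  choose κ hκ hκz using hloc
  obtain ⟨k, hk⟩ := hπ.1
  obtain ⟨ε, hε, k', hk', hz⟩ := I.exists_cutoff π hk
  have hcpt : ∃ C : Set X, IsCompact C ∧ ∀ y ∉ C, (k' : C₀(X, KOp H)) y = 0 := by
    have h1 : ∀ᶠ y in Filter.cocompact X, ‖(k : C₀(X, KOp H)) y‖ < ε := by
      have := (k : C₀(X, KOp H)).zero_at_infty'.norm
      rw [norm_zero] at this
      exact this.eventually_lt_const hε
    obtain ⟨C, hC, hCk⟩ := Filter.mem_cocompact.1 h1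
    exact ⟨C, hC, fun y hy => hz y (hCk hy)⟩
  obtain ⟨C, hC, hCk⟩ := hcpt
  obtain ⟨t, -, ht⟩ := hC.elim_nhds_subcover (fun x => {y | (κ x : C₀(X, KOp H)) y = 0})
    fun x _ => hκz x
  -- Primeness of the kernel keeps a finite product outside it, while the product vanishes wherever
  -- one factor does. Finitely many `κ x` cover the set `C` off which `k'` vanishes, so the product
  -- is zero.
  have hprod : ∀ t : Finset X, ∃ a : I.fixedAlgebra, π a ≠ 0 ∧ ∀ y,
      ((k' : C₀(X, KOp H)) y = 0 ∨ ∃ x ∈ t, (κ x : C₀(X, KOp H)) y = 0) →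
        (a : C₀(X, KOp H)) y = 0 := by
    classical
    intro t
    induction t using Finset.induction_on with
    | empty => exact ⟨k', hk', fun y hy => by simpa using hy⟩
    | insert x t _ ih =>
      obtain ⟨a, ha, haz⟩ := ih
      obtain ⟨c, hc⟩ := hπ.exists_mul_mul_ne_zero ha (hκ x)
      refine ⟨_, hc, fun y hy => ?_⟩
      change (a : C₀(X, KOp H)) y * (c : C₀(X, KOp H)) y * (κ x : C₀(X, KOp H)) y = 0
      rcases hy with hy | ⟨x', hx', hy⟩
      · rw [haz y (Or.inl hy), zero_mul, zero_mul]
      · rcases Finset.mem_insert.1 hx' with rfl | hx'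
        · rw [hy, mul_zero]
        · rw [haz y (Or.inr ⟨x', hx', hy⟩), zero_mul, zero_mul]
  obtain ⟨a, ha, haz⟩ := hprod t
  refine ha ?_
  have ha0 : a = 0 := Subtype.ext (ZeroAtInftyContinuousMap.ext fun y => haz y ?_)
  · rw [ha0, map_zero]
  · by_cases hy : y ∈ C
    · obtain ⟨x, hx, hxy⟩ := Set.mem_iUnion₂.1 (ht hy)
      exact Or.inr ⟨x, hx, hxy⟩
    · exact Or.inl (hCk y hy)

/-- Every irreducible representation of the fixed-point algebra is equivalent to some
`π_{x, ρ}`. -/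
theorem BundleAction.exists_repEquiv_rep [Finite W] [LocallyCompactSpace X] [T2Space X]
    [ContinuousConstSMul W X] (I : BundleAction W X H) {K : Type z}
    [NormedAddCommGroup K] [InnerProductSpace ℂ K] [CompleteSpace K]
    (π : I.fixedAlgebra →⋆ₙₐ[ℂ] (K →L[ℂ] K)) (hπ : IsIrreducibleRep π) :
    ∃ (x : X) (ρ : UnitaryIrrep.{u, r} (MulAction.stabilizer W x)),
      Occurs ρ.hom (I.isotropyRep x) ∧ RepEquiv π (I.rep x ρ) := by
  obtain ⟨x, hx⟩ := I.exists_forall_eq_zero hπ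
  have hfac : ∀ k l, I.evalAt x k = I.evalAt x l → π k = π l := by
    intro k l h
    rw [← sub_eq_zero, ← map_sub]
    refine hx _ (I.evalAt_eq_zero_iff.1 ?_)
    rw [map_sub, h, sub_self]
  -- By `hfac` the value of `π` does not depend on the chosen lift, so an arbitrary section still
  -- induces a `*`-homomorphism.
  choose ext hext using I.evalAt_surjective x
  let σ : equivariantCompacts (I.isotropyRep x) →⋆ₙₐ[ℂ] (K →L[ℂ] K) :=
    { toFun := fun T => π (ext T)
      map_smul' := fun c T => by
        rw [MonoidHom.id_apply, ← map_smul]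
        exact hfac _ _ (by rw [hext, map_smul, hext])
      map_zero' := by
        rw [← map_zero π]
        exact hfac _ _ (by rw [hext, map_zero])
      map_add' := fun S T => by
        rw [← map_add]
        exact hfac _ _ (by rw [hext, map_add, hext, hext])
      map_mul' := fun S T => by
        rw [← map_mul]
        exact hfac _ _ (by rw [hext, map_mul, hext, hext])
      map_star' := fun T => by
        rw [← map_star]
        exact hfac _ _ (by rw [hext, map_star, hext]) }
  have hσ : ∀ k, σ (I.evalAt x k) = π k := fun k => hfac _ _ (hext _)
  have hirr : IsIrreducibleRep σ := by
    obtain ⟨⟨k, hk⟩, h⟩ := hπ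
    exact ⟨⟨I.evalAt x k, by rwa [hσ]⟩, fun S hS hinv => h S hS fun k ξ hξ => by
      rw [← hσ]
      exact hinv _ ξ hξ⟩
  obtain ⟨ρ, hρ, t, ht⟩ := exists_repEquiv_hsRep.{u, w, r, z} σ hirr
  exact ⟨x, ρ, hρ, t, fun k ξ => by rw [← hσ, ht, I.rep_eq]⟩

end Localization

/-! ### Recovering `ρ` from its representation of `K(H)^G`. -/

section RepEquiv

variable {A : Type u} [NonUnitalRing A] [StarRing A] [Module ℂ A]
  {K₁ : Type v} [NormedAddCommGroup K₁] [InnerProductSpace ℂ K₁] [CompleteSpace K₁]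
  {K₂ : Type w} [NormedAddCommGroup K₂] [InnerProductSpace ℂ K₂] [CompleteSpace K₂]
  {K₃ : Type z} [NormedAddCommGroup K₃] [InnerProductSpace ℂ K₃] [CompleteSpace K₃]
  {π₁ : A →⋆ₙₐ[ℂ] (K₁ →L[ℂ] K₁)} {π₂ : A →⋆ₙₐ[ℂ] (K₂ →L[ℂ] K₂)} {π₃ : A →⋆ₙₐ[ℂ] (K₃ →L[ℂ] K₃)}

theorem RepEquiv.symm (h : RepEquiv π₁ π₂) : RepEquiv π₂ π₁ := by
  obtain ⟨t, ht⟩ := h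
  exact ⟨t.symm, fun a ξ => by
    rw [LinearIsometryEquiv.symm_apply_eq, ht, LinearIsometryEquiv.apply_symm_apply]⟩

theorem RepEquiv.trans (h : RepEquiv π₁ π₂) (h' : RepEquiv π₂ π₃) : RepEquiv π₁ π₃ := by
  obtain ⟨t, ht⟩ := h
  obtain ⟨s, hs⟩ := h'
  exact ⟨t.trans s, fun a ξ => by simp [ht, hs]⟩

theorem RepEquiv.apply_ne_zero (h : RepEquiv π₁ π₂) {a : A} (ha : π₁ a ≠ 0) : π₂ a ≠ 0 := by
  obtain ⟨t, ht⟩ := h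
  refine fun h0 => ha (ContinuousLinearMap.ext fun ξ => t.injective ?_)
  rw [ht, h0, zero_apply, zero_apply, map_zero]

end RepEquiv

section Intertwiners

variable {G : Type u} [Group G]
  {V : Type v} [NormedAddCommGroup V] [InnerProductSpace ℂ V] [FiniteDimensional ℂ V]
  [CompleteSpace V] {H : Type w} [NormedAddCommGroup H] [InnerProductSpace ℂ H] [CompleteSpace H]
  {ρ : G →* (V ≃ₗᵢ[ℂ] V)} {π : G →* (H ≃ₗᵢ[ℂ] H)}

/-- A nonzero intertwiner between irreducible representations is a multiple of a unitary one. -/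
theorem HSInt.exists_equiv (hρ : IsIrreducibleUnitary ρ) (hπ : IsIrreducibleUnitary π)
    {s : HSInt ρ π} (hs : s ≠ 0) : ∃ t : V ≃ₗᵢ[ℂ] H, ∀ g ζ, t (ρ g ζ) = π g (t ζ) := by
  have := hρ.1
  have hn : 0 < Module.finrank ℂ V := Module.finrank_pos
  have hs' := norm_pos_iff.2 hs
  set c : ℝ := ‖s‖ / √(Module.finrank ℂ V) with hc
  have hc0 : 0 < c := by positivity
  have hnorm : ∀ ζ, ‖s.toCLM ζ‖ = c * ‖ζ‖ := by
    intro ζ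
    rw [← sq_eq_sq₀ (norm_nonneg _) (by positivity), mul_pow, hc, div_pow,
      Real.sq_sqrt (by positivity)]
    have h : ⟪s.toCLM ζ, s.toCLM ζ⟫_ℂ = (⟪s, s⟫_ℂ / Module.finrank ℂ V) * ⟪ζ, ζ⟫_ℂ := by
      rw [← ContinuousLinearMap.adjoint_inner_right, HSInt.adjoint_apply_apply hρ,
        inner_smul_right]
    simp only [inner_self_eq_norm_sq_to_K, RCLike.ofReal_eq_complex_ofReal] at h
    exact_mod_cast h
  let U : V →ₗᵢ[ℂ] H :=
    { toLinearMap := ((c⁻¹ : ℝ) : ℂ) • (s.toCLM : V →ₗ[ℂ] H)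
      norm_map' := fun ζ => by
        rw [LinearMap.smul_apply, norm_smul, ContinuousLinearMap.coe_coe, hnorm,
          Complex.norm_real, Real.norm_of_nonneg (by positivity), inv_mul_cancel_left₀ hc0.ne'] }
  have hU : ∀ ζ, U ζ = ((c⁻¹ : ℝ) : ℂ) • s.toCLM ζ := fun _ => rfl
  have hUeq : ∀ g ζ, U (ρ g ζ) = π g (U ζ) := fun g ζ => by
    rw [hU, hU, s.equivariant, map_smul]
  have hrange : LinearMap.range U.toLinearMap = ⊤ := by
    refine (hπ.2 _ U.isometry.isClosedEmbedding.isClosed_range ?_).resolve_left fun h0 => ?_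
    · rintro g _ ⟨ζ, rfl⟩
      exact ⟨_, hUeq g ζ⟩
    · obtain ⟨ζ, hζ⟩ := exists_ne (0 : V)
      have h1 : U ζ ∈ LinearMap.range U.toLinearMap := ⟨ζ, rfl⟩
      rw [h0, Submodule.mem_bot] at h1
      rw [← map_zero U, U.injective.eq_iff] at h1
      exact hζ h1
  exact ⟨LinearIsometryEquiv.ofSurjective U (LinearMap.range_eq_top.1 hrange), hUeq⟩

theorem hsRep_compAdjoint_self_ne_zero (hρ : IsIrreducibleUnitary ρ) {s : HSInt ρ π}
    (hs : s ≠ 0) : hsRep π ρ (s.compAdjoint s) ≠ 0 := by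
  intro h0
  have h := hsRep_compAdjoint hρ s s s
  rw [h0, zero_apply] at h
  exact smul_ne_zero (div_ne_zero (inner_self_ne_zero.2 hs) hρ.finrank_ne_zero) hs h.symm

/-- If the representations of `K(H)^G` on `HS(ρ₁, π)^G` and `HS(ρ₂, π)^G` are equivalent, then
so are `ρ₁` and `ρ₂`. -/
theorem UnitaryIrrep.equiv_of_repEquiv_hsRep [Finite G] {ρ₁ ρ₂ : UnitaryIrrep.{u, r} G}
    (ho : Occurs ρ₁.hom π) (h : RepEquiv (hsRep π ρ₁.hom) (hsRep π ρ₂.hom)) :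
    ρ₂.Equiv ρ₁ := by
  obtain ⟨s, hs⟩ := ho.exists_intertwiner ρ₁.irreducible
  have h1 := h.apply_ne_zero (hsRep_compAdjoint_self_ne_zero ρ₁.irreducible hs)
  obtain ⟨t, ht⟩ : ∃ t, hsRep π ρ₂.hom (s.compAdjoint s) t ≠ 0 := by
    by_contra! h0
    exact h1 (ContinuousLinearMap.ext h0)
  -- `s s*` acts nontrivially for `ρ₁`, hence for `ρ₂`: some `s s* t` is nonzero, and so is `s* t :
  -- ρ₂ → ρ₁`.
  let q : HSInt ρ₂.hom ρ₁.hom :=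
    HSInt.mk (ContinuousLinearMap.adjoint s.toCLM ∘L t.toCLM) fun g ζ => by
      rw [ContinuousLinearMap.comp_apply, t.equivariant, adjoint_equivariant s.equivariant]
      rfl
  refine HSInt.exists_equiv ρ₂.irreducible ρ₁.irreducible (s := q) fun h0 => ht ?_
  ext ζ
  have h2 : ContinuousLinearMap.adjoint s.toCLM (t.toCLM ζ) = 0 := congr(HSInt.toCLM $h0 ζ)
  change s.toCLM (ContinuousLinearMap.adjoint s.toCLM (t.toCLM ζ)) = _
  rw [h2, map_zero]
  rfl

end Intertwiners

theorem UnitaryIrrep.Equiv.symm {G : Type u} [Group G] {ρ₁ ρ₂ : UnitaryIrrep.{u, r} G}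
    (h : ρ₁.Equiv ρ₂) : ρ₂.Equiv ρ₁ :=
  (UnitaryIrrep.setoid G).symm h

theorem UnitaryIrrep.Equiv.trans {G : Type u} [Group G] {ρ₁ ρ₂ ρ₃ : UnitaryIrrep.{u, r} G}
    (h : ρ₁.Equiv ρ₂) (h' : ρ₂.Equiv ρ₃) : ρ₁.Equiv ρ₃ :=
  (UnitaryIrrep.setoid G).trans h h'

/-- Conjugation by an element of the isotropy group is inner, so `ρ(g⁻¹)` is the intertwiner. -/
theorem conjIrrep_equiv_self {W : Type u} [Group W] {X : Type v} [MulAction W X]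
    {g : W} {x : X} (h : x = g • x)
    (ρ : UnitaryIrrep.{u, r} (MulAction.stabilizer W x)) : ρ.Equiv (conjIrrep g h ρ) := by
  let γ : MulAction.stabilizer W x := ⟨g, h.symm⟩
  refine ⟨ρ.hom γ⁻¹, fun a ζ => ?_⟩
  change ρ.hom γ⁻¹ (ρ.hom a ζ) = ρ.hom (stabilizerConj g h a) (ρ.hom γ⁻¹ ζ)
  have h1 : γ⁻¹ * a = stabilizerConj g h a * γ⁻¹ := by
    ext
    change g⁻¹ * (a : W) = g⁻¹ * a * g * g⁻¹
    group
  have h2 := congr(ρ.hom $h1 ζ)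
  rw [map_mul, map_mul] at h2
  exact h2

/-! ### Transport along orbits and the bijection with the dual. -/

section Transport

variable {W : Type u} [Group W] {X : Type v} [TopologicalSpace X] [MulAction W X]
  {H : Type w} [NormedAddCommGroup H] [InnerProductSpace ℂ H]

theorem BundleAction.I_isotropyRep (I : BundleAction W X H) (g : W) {x₁ x₂ : X}
    (h : x₂ = g • x₁) (a : MulAction.stabilizer W x₂) (ξ : H) :
    I.I g x₁ (I.isotropyRep x₁ (stabilizerConj g h a) ξ) =
      I.isotropyRep x₂ a (I.I g x₁ ξ) := by
  change I.I g x₁ (I.I (g⁻¹ * a * g) x₁ ξ) = I.I a x₂ (I.I g x₁ ξ)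
  have h1 : (g⁻¹ * (a : W) * g) • x₁ = x₁ := (stabilizerConj g h a).2
  have h2 := I.I_mul_apply g (g⁻¹ * a * g) x₁ ξ
  rw [h1, show g * (g⁻¹ * (a : W) * g) = a * g by group, I.I_mul_apply, ← h] at h2
  exact h2.symm

theorem BundleAction.occurs_conjIrrep (I : BundleAction W X H) (g : W) {x₁ x₂ : X}
    (h : x₂ = g • x₁) {ρ : UnitaryIrrep.{u, r} (MulAction.stabilizer W x₁)}
    (hρ : Occurs ρ.hom (I.isotropyRep x₁)) :
    Occurs (conjIrrep g h ρ).hom (I.isotropyRep x₂) := by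
  obtain ⟨t, ht⟩ := hρ
  refine ⟨(I.I g x₁).toLinearIsometry.comp t, fun a ζ => ?_⟩
  exact (congrArg (I.I g x₁) (ht (stabilizerConj g h a) ζ)).trans (I.I_isotropyRep g h a _)

variable [CompleteSpace H]

theorem BundleAction.fixedAlgebra_apply_smul (I : BundleAction W X H) (k : I.fixedAlgebra)
    (g : W) (x : X) (ξ : H) : ((k : C₀(X, KOp H)) (g • x)).toCLM (I.I g x ξ) =
      I.I g x (((k : C₀(X, KOp H)) x).toCLM ξ) := by
  rw [← k.2 g (g • x), I.alpha_apply, inv_smul_smul, LinearIsometryEquiv.symm_apply_apply]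

variable [Finite W]

/-- The representations `π_{x, ρ}` and `π_{gx, gρ}` are equivalent. -/
theorem BundleAction.repEquiv_conjIrrep (I : BundleAction W X H) (g : W) {x₁ x₂ : X}
    (h : x₂ = g • x₁) (ρ : UnitaryIrrep.{u, r} (MulAction.stabilizer W x₁)) :
    RepEquiv (I.rep x₁ ρ) (I.rep x₂ (conjIrrep g h ρ)) := by
  let e : HSInt ρ.hom (I.isotropyRep x₁) ≃ₗ[ℂ]
      HSInt (conjIrrep g h ρ).hom (I.isotropyRep x₂) :=
    { toFun := fun s => HSInt.mk (V := ρ.carrier) ((I.I g x₁ : H →L[ℂ] H) ∘L s.toCLM)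
        fun a ζ => by
          change I.I g x₁ (s.toCLM (ρ.hom (stabilizerConj g h a) ζ)) =
            I.isotropyRep x₂ a (I.I g x₁ (s.toCLM ζ))
          rw [s.equivariant, I.I_isotropyRep]
      invFun := fun s => HSInt.mk (V := ρ.carrier)
        (((I.I g x₁).symm : H →L[ℂ] H) ∘L (s.toCLM : ρ.carrier →L[ℂ] H)) fun a ζ => by
          change (I.I g x₁).symm (s.toCLM (ρ.hom a ζ)) =
            I.isotropyRep x₁ a ((I.I g x₁).symm (s.toCLM ζ))
          obtain ⟨b, rfl⟩ := (stabilizerConj g h).surjective a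
          rw [LinearIsometryEquiv.symm_apply_eq, I.I_isotropyRep,
            LinearIsometryEquiv.apply_symm_apply]
          exact s.equivariant b ζ
      map_add' := fun a b => HSInt.ext fun ζ => map_add (I.I g x₁) _ _
      map_smul' := fun c a => HSInt.ext fun ζ => map_smul (I.I g x₁) c _
      left_inv := fun s => HSInt.ext fun ζ => (I.I g x₁).symm_apply_apply _
      right_inv := fun s => HSInt.ext fun ζ => (I.I g x₁).apply_symm_apply _ }
  refine ⟨⟨e, fun s => ?_⟩, fun k s => HSInt.ext fun ζ => ?_⟩
  · let b := stdOrthonormalBasis ℂ ρ.carrier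
    let b' : OrthonormalBasis _ ℂ (conjIrrep g h ρ).carrier := b
    rw [← sq_eq_sq₀ (norm_nonneg _) (norm_nonneg _), HSInt.norm_sq s b, HSInt.norm_sq (e s) b']
    exact Finset.sum_congr rfl fun i _ => congrArg (· ^ 2) ((I.I g x₁).norm_map _)
  · subst h
    exact (I.fixedAlgebra_apply_smul k g x₁ (s.toCLM ζ)).symm

variable [LocallyCompactSpace X] [T2Space X] [ContinuousConstSMul W X]

/-- Equivalent representations `π_{x, ρ}` at the same point come from equivalent `ρ`. -/
theorem BundleAction.equiv_of_repEquiv_rep (I : BundleAction W X H) {x : X}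
    {ρ₁ ρ₂ : UnitaryIrrep.{u, r} (MulAction.stabilizer W x)}
    (ho : Occurs ρ₁.hom (I.isotropyRep x)) (h : RepEquiv (I.rep x ρ₁) (I.rep x ρ₂)) :
    ρ₂.Equiv ρ₁ := by
  obtain ⟨t, ht⟩ := h
  refine UnitaryIrrep.equiv_of_repEquiv_hsRep ho ⟨t, fun T ξ => ?_⟩
  obtain ⟨k, rfl⟩ := I.evalAt_surjective x T
  exact ht k ξ

/-- Points on different orbits are separated by an element of the algebra with value `s s*` at `x₁`
and 0 at `x₂`: it acts nontrivially in the first representation and as 0 in the second. -/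
theorem BundleAction.mem_orbit_of_repEquiv_rep (I : BundleAction W X H) {x₁ x₂ : X}
    {ρ₁ : UnitaryIrrep.{u, r} (MulAction.stabilizer W x₁)}
    {ρ₂ : UnitaryIrrep.{u, r} (MulAction.stabilizer W x₂)}
    (ho : Occurs ρ₁.hom (I.isotropyRep x₁)) (h : RepEquiv (I.rep x₁ ρ₁) (I.rep x₂ ρ₂)) :
    x₂ ∈ MulAction.orbit W x₁ := by
  by_contra hx
  obtain ⟨s, hs⟩ := ho.exists_intertwiner ρ₁.irreducible
  obtain ⟨k, hk₁, hk₂⟩ := I.exists_fixedAlgebra_apply_eq (s.compAdjoint s).2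
    (Set.finite_singleton x₂) (by rintro _ rfl; exact hx)
  have h1 : I.evalAt x₁ k = s.compAdjoint s := Subtype.ext hk₁
  refine h.apply_ne_zero (a := k) ?_ ?_
  · rw [I.rep_eq, h1]
    exact hsRep_compAdjoint_self_ne_zero ρ₁.irreducible hs
  · rw [I.rep_eq, I.evalAt_eq_zero_iff.2 (hk₂ x₂ rfl), map_zero]

theorem BundleAction.repEquiv_rep_iff (I : BundleAction W X H) {x₁ x₂ : X}
    {ρ₁ : UnitaryIrrep.{u, r} (MulAction.stabilizer W x₁)}
    {ρ₂ : UnitaryIrrep.{u, r} (MulAction.stabilizer W x₂)}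
    (ho : Occurs ρ₁.hom (I.isotropyRep x₁)) :
    RepEquiv (I.rep x₁ ρ₁) (I.rep x₂ ρ₂) ↔
      ∃ (g : W) (h : x₂ = g • x₁), ρ₂.Equiv (conjIrrep g h ρ₁) := by
  constructor
  · intro h
    obtain ⟨g, hg⟩ := I.mem_orbit_of_repEquiv_rep ho h
    refine ⟨g, hg.symm, I.equiv_of_repEquiv_rep (I.occurs_conjIrrep g hg.symm ho) ?_⟩
    exact (I.repEquiv_conjIrrep g hg.symm ρ₁).symm.trans h
  · rintro ⟨g, h, he⟩
    exact (I.repEquiv_conjIrrep g h ρ₁).trans (I.rep_congr x₂ _ _ he.symm)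

/-- The classification of the dual by pairs of an orbit and a representation of the isotropy
group of its chosen point. -/
theorem BundleAction.bijOn_repClass (I : BundleAction W X H)
    {c : MulAction.orbitRel.Quotient W X → X}
    (hc : ∀ o, (Quotient.mk _ (c o) : MulAction.orbitRel.Quotient W X) = o) :
    Set.BijOn (fun p => I.repClass (c p.1) p.2) (BundleAction.orbitPairs.{u, v, w, r} I c)
      (dual.{max v w, max r w} I.fixedAlgebra) := by
  have hp : ∀ p ∈ BundleAction.orbitPairs.{u, v, w, r} I c,
      ∃ (o : _) (ρ : UnitaryIrrep.{u, r} (MulAction.stabilizer W (c o))),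
        Occurs ρ.hom (I.isotropyRep (c o)) ∧ p = ⟨o, Quotient.mk _ ρ⟩ := by
    rintro ⟨o, q⟩ ⟨ρ, hρ, h⟩
    exact ⟨o, ρ, hρ, congrArg (Sigma.mk o) h.symm⟩
  refine ⟨?_, ?_, ?_⟩
  · intro p hp'
    obtain ⟨o, ρ, hρ, rfl⟩ := hp p hp'
    exact ⟨⟨_, I.rep (c o) ρ⟩, I.isIrreducibleRep_rep _ ρ hρ, rfl⟩
  · intro p hp₁ q hp₂ h
    obtain ⟨o₁, ρ₁, hρ₁, rfl⟩ := hp p hp₁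
    obtain ⟨o₂, ρ₂, -, rfl⟩ := hp q hp₂
    have h1 : RepEquiv (I.rep (c o₁) ρ₁) (I.rep (c o₂) ρ₂) := Quotient.exact h
    obtain ⟨g, hg, he⟩ := (I.repEquiv_rep_iff hρ₁).1 h1
    -- Once the orbits agree, `g` fixes the chosen point, and twisting by it does not change the
    -- class of `ρ₁`.
    obtain rfl : o₂ = o₁ := by
      rw [← hc o₁, ← hc o₂]
      exact Quotient.sound ⟨g, hg.symm⟩
    have h2 : (Quotient.mk _ ρ₁ : UnitaryDual.{u, r} (MulAction.stabilizer W (c o₂))) =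
        Quotient.mk _ ρ₂ := Quotient.sound ((conjIrrep_equiv_self hg ρ₁).trans he.symm)
    exact congrArg (Sigma.mk o₂) h2
  · rintro _ ⟨π, hπ, rfl⟩
    obtain ⟨x, ρ, hρ, h⟩ := BundleAction.exists_repEquiv_rep.{u, v, w, r} I π.hom hπ
    -- The point `x` supplied by the classification need not be the chosen one of its orbit, so the
    -- pair is moved there by `g`.
    obtain ⟨g, hg⟩ : c (Quotient.mk _ x) ∈ MulAction.orbit W x := Quotient.exact (hc _)
    refine ⟨⟨Quotient.mk _ x, Quotient.mk _ (conjIrrep g hg.symm ρ)⟩,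
      ⟨_, I.occurs_conjIrrep g hg.symm hρ, rfl⟩, ?_⟩
    exact Quotient.sound (h.trans (I.repEquiv_conjIrrep g hg.symm ρ)).symm

end Transport

end

end EquivariantCompacts

theorem mainTheorem7
    {W : Type u} [Group W] [Finite W]
    {X : Type v} [TopologicalSpace X] [LocallyCompactSpace X] [T2Space X]
    [MulAction W X] [ContinuousConstSMul W X]
    {H : Type w} [NormedAddCommGroup H] [InnerProductSpace ℂ H] [CompleteSpace H]
    (I : EquivariantCompacts.BundleAction W X H) :
    -- (1) the representations `π_{x, ρ}` are irreducible
    (∀ (x : X) (ρ : EquivariantCompacts.UnitaryIrrep.{u, r} (MulAction.stabilizer W x)),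
      EquivariantCompacts.Occurs ρ.hom (I.isotropyRep x) →
        EquivariantCompacts.IsIrreducibleRep (I.rep x ρ)) ∧
    -- (2) every irreducible representation is equivalent to some `π_{x, ρ}`
    (∀ (K : Type z) [NormedAddCommGroup K] [InnerProductSpace ℂ K] [CompleteSpace K]
      (π : I.fixedAlgebra →⋆ₙₐ[ℂ] (K →L[ℂ] K)),
      EquivariantCompacts.IsIrreducibleRep π →
        ∃ (x : X) (ρ : EquivariantCompacts.UnitaryIrrep.{u, r} (MulAction.stabilizer W x)),
          EquivariantCompacts.Occurs ρ.hom (I.isotropyRep x) ∧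
            EquivariantCompacts.RepEquiv π (I.rep x ρ)) ∧
    -- (3) equivalence of `π_{x₁, ρ₁}` and `π_{x₂, ρ₂}`
    (∀ (x₁ x₂ : X)
      (ρ₁ : EquivariantCompacts.UnitaryIrrep.{u, r} (MulAction.stabilizer W x₁))
      (ρ₂ : EquivariantCompacts.UnitaryIrrep.{u, r} (MulAction.stabilizer W x₂)),
      EquivariantCompacts.Occurs ρ₁.hom (I.isotropyRep x₁) →
      EquivariantCompacts.Occurs ρ₂.hom (I.isotropyRep x₂) →
        (EquivariantCompacts.RepEquiv (I.rep x₁ ρ₁) (I.rep x₂ ρ₂) ↔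
          ∃ (g : W) (h : x₂ = g • x₁),
            EquivariantCompacts.UnitaryIrrep.Equiv ρ₂
              (EquivariantCompacts.conjIrrep g h ρ₁))) ∧
    -- (4) `(Wx, [ρ]) ↦ [π_{x, ρ}]` is a bijection onto the dual, for every choice `c` of a
    -- representative point in each orbit
    (∀ c : MulAction.orbitRel.Quotient W X → X,
      (∀ o, (Quotient.mk _ (c o) : MulAction.orbitRel.Quotient W X) = o) →
        Set.BijOn (fun p => I.repClass (c p.1) p.2)
          (EquivariantCompacts.BundleAction.orbitPairs.{u, v, w, r} I c)
          (EquivariantCompacts.dual.{max v w, max r w} I.fixedAlgebra)) := by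
  refine ⟨fun x ρ hρ => I.isIrreducibleRep_rep x ρ hρ, fun K _ _ _ π hπ => ?_,
    fun x₁ x₂ ρ₁ ρ₂ ho _ => I.repEquiv_rep_iff ho, fun c hc => I.bijOn_repClass hc⟩
  exact EquivariantCompacts.BundleAction.exists_repEquiv_rep.{u, v, w, r, z} I π hπ
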